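/- Let $p_1,p_2$ be primes, $N=p_1p_2$, $r=(p_1-1)(p_2-1)/24$, $s=24/\gcd(24,(p_1-1)(p_2-1))$, and let $e,\delta$ be positive integers such that either $e\mid s$, $e\neq s$, $\delta=s/e$ and $N\equiv 1 \pmod \delta$, or, up to exchanging $p_1$ and $p_2$, $(p_1,p_2;e,\delta)$ is one of the following (congruences modulo $12$): $(2,2;8,3)$, $(2,5;2,3)$, $(2,11;4,3)$, $(3,3;3,2)$, $(3,7;1,2)$, $(3,11;3,2)$, $(5,5;1,3)$, $(5,11;1,3)$, $(7,7;1,2)$, $(7,11;1,2)$, $(11,11;1,6)$, where an entry $2$ or $3$ for a prime means that prime and an entry $5$, $7$ or $11$ means any prime in that class modulo $12$. Let $\eta$ be Dedekind's function, $q=e^{2\pi i z}$, $\zeta_n=e^{2\pi i/n}$, $\phi=\zeta_{24}^{(p_1-1)(p_2-1)}$, $\chi=\phi^{-e}$, and let $\alpha_0=1,0,3$ for $\delta=2,3,6$ respectively. For $z$ in the upper half-plane put $$B'=\left(\frac{\eta(p_1z)\eta(p_2z)}{\eta(z)\eta(Nz)}\right)^e,\qquad A'_\nu=\chi^{\alpha_0-\nu}\left(\frac{\eta(\frac{z+\nu}{p_1})\eta(\frac{z+\nu}{p_2})}{\eta(z+\nu)\eta(\frac{z+\nu}{N})}\right)^e\quad(0\le\nu<N).$$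 If $p_1\ne p_2$, let $u,v\in\mathbb Z$ with $up_1+vp_2=1$, and for $0\le\nu<p_2$ put $$C_{2,\nu}=\phi^{\theta_2(\nu)}\varepsilon_2\frac{\eta(p_1(z+\nu))\,\eta(\frac{z+\nu}{p_2})}{\eta(z+\nu)\,\eta(\frac{p_1(z+\nu)}{p_2})},\qquad C'_{2,\nu}=\chi^{\theta_2(\nu)-\nu}C_{2,\nu}^e .$$ Here, if $p_2\neq2$, $\varepsilon_2=\left(\frac{p_1}{p_2}\right)$, $\theta_2(0)=uv(p_2+1)+u-1$, and for $\nu>0$, $\theta_2(\nu)=\mu((p_2+1)v_2+1)+\nu$ with $1\le\mu<p_2$, $\mu\equiv-(\nu p_1)^{-1}\pmod{p_2}$ and $v_2=(1+p_1\mu\nu)/p_2$; if $p_2=2$, $\varepsilon_2=1$, $\theta_2(0)=(3u+2)(u-1)/2$ and $\theta_2(1)=3p_1+2$. Define $C'_{1,\nu}$ ($0\le\nu<p_1$) in the same way with $(p_1,u)$ and $(p_2,v)$ exchanged. If $p_1=p_2=p$, for $1\le\nu<p$ let $1\le\mu<p$ and $w\in\mathbb Z$ be such that $1=-\mu\nu+wp$,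 and put $$C'_\nu=\chi^{\mu}\left(\sqrt p\,\varepsilon(\nu)\,\zeta_{24}^{\theta(\nu)}\frac{\eta(pz)^2}{\eta(z)\,\eta(z+\frac{\nu}{p})}\right)^e,$$ where $\varepsilon(\nu)=\left(\frac{-\nu}{p}\right)$ and $\theta(\nu)=p\nu(1-\mu^2)+(-3p+2+w)\mu-3+3p$ for $p$ odd, and $\varepsilon(\nu)=1$, $\theta(\nu)=0$ for $p=2$. Let $\Phi(F)=\prod(F-f)$, where $f$ runs over $B'$, the $A'_\nu$ and, if $p_1\neq p_2$, the $C'_{1,\nu}$ and $C'_{2,\nu}$, respectively, if $p_1=p_2$, the $C'_\nu$. The coefficients of $\Phi$, and its trace (the sum of all these $f$), are convergent Puiseux series in $q$ on the upper half-plane, and: (a) put $m=p_1+p_2$ if $p_1\ne p_2$ and $m=p-1$ if $p_1=p_2=p$; the coefficient of $F^m$ in $\Phi$ has order $-2re$ with leading term $\pm q^{-2re}$, and the coefficient of $F^k$ has strictly larger order for every $k\neq m$; (b) the trace has a pole of order $re$ at $q=0$: it is $q^{-re}$ plus terms of strictly larger order; (c) if $p_1\ne p_2$, then $\Phi(0)=1$;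 (d) if $p_1=p_2=p$, then $\Phi(0)=(-p)^{e(p-1)/2}$ if $p$ is odd, and $\Phi(0)=2^4$ if $p=2$. -/

import Mathlib

open UpperHalfPlane

noncomputable section

namespace DoubleEta

/-- The primitive root of unity `ζ_n = exp (2πi/n)`. -/
def zeta (n : ℕ) : ℂ := Complex.exp (2 * Real.pi * Complex.I / n)

/-- `s = 24 / gcd (24, (p₁ - 1)(p₂ - 1))`. -/
def sExp (p₁ p₂ : ℕ) : ℕ := 24 / Nat.gcd 24 ((p₁ - 1) * (p₂ - 1))

/-- The rational number `r = (p₁ - 1)(p₂ - 1) / 24`. -/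
def rExp (p₁ p₂ : ℕ) : ℚ := ((p₁ : ℚ) - 1) * ((p₂ : ℚ) - 1) / 24

/-- The rows `(p₁, p₂, e, δ)` of the table of parameters. -/
def IsTableRow (p₁ p₂ e δ : ℕ) : Prop :=
  (p₁ = 2 ∧ p₂ = 2 ∧ e = 8 ∧ δ = 3) ∨
  (p₁ = 2 ∧ p₂ % 12 = 5 ∧ e = 2 ∧ δ = 3) ∨
  (p₁ = 2 ∧ p₂ % 12 = 11 ∧ e = 4 ∧ δ = 3) ∨
  (p₁ = 3 ∧ p₂ = 3 ∧ e = 3 ∧ δ = 2) ∨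
  (p₁ = 3 ∧ p₂ % 12 = 7 ∧ e = 1 ∧ δ = 2) ∨
  (p₁ = 3 ∧ p₂ % 12 = 11 ∧ e = 3 ∧ δ = 2) ∨
  (p₁ % 12 = 5 ∧ p₂ % 12 = 5 ∧ e = 1 ∧ δ = 3) ∨
  (p₁ % 12 = 5 ∧ p₂ % 12 = 11 ∧ e = 1 ∧ δ = 3) ∨
  (p₁ % 12 = 7 ∧ p₂ % 12 = 7 ∧ e = 1 ∧ δ = 2) ∨
  (p₁ % 12 = 7 ∧ p₂ % 12 = 11 ∧ e = 1 ∧ δ = 2) ∨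
  (p₁ % 12 = 11 ∧ p₂ % 12 = 11 ∧ e = 1 ∧ δ = 6)

/-- Admissible parameters: `e ≠ s` is a divisor of `s`, `δ = s / e` and `p₁ p₂ ≡ 1 mod δ`,
or `(p₁, p₂, e, δ)` is a row of the table, in either order of the primes. (Apart from the order of
the primes, the only rows that the first alternative does not cover are those with
`p₁ = 2`, `p₂ ≡ 17 mod 24`, `e = 2`, where `s = 3`.) -/
def Admissible (p₁ p₂ e δ : ℕ) : Prop :=
  (e ∣ sExp p₁ p₂ ∧ e ≠ sExp p₁ p₂ ∧ δ = sExp p₁ p₂ / e ∧ p₁ * p₂ ≡ 1 [MOD δ]) ∨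
    IsTableRow p₁ p₂ e δ ∨ IsTableRow p₂ p₁ e δ

/-- `φ = ζ₂₄ ^ ((p₁ - 1)(p₂ - 1))`. -/
def phi (p₁ p₂ : ℕ) : ℂ := zeta 24 ^ ((p₁ - 1) * (p₂ - 1))

/-- `χ = φ ^ (-e)`. -/
def chi (p₁ p₂ e : ℕ) : ℂ := phi p₁ p₂ ^ (-(e : ℤ))

/-- `α₀`, which is `1`, `0`, `3` for `δ = 2`, `3`, `6`. -/
def alpha0 (δ : ℕ) : ℤ := if δ = 2 then 1 else if δ = 3 then 0 else 3

/-- The double eta quotient `𝔴_{p₁,p₂}(z) = η(z/p₁) η(z/p₂) / (η(z/(p₁p₂)) η(z))`. -/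
def doubleEta (p₁ p₂ : ℕ) (z : ℂ) : ℂ :=
  ModularForm.eta (z / p₁) * ModularForm.eta (z / p₂) /
    (ModularForm.eta (z / (p₁ * p₂)) * ModularForm.eta z)

/-- The conjugate `A_ν(z) = 𝔴_{p₁,p₂}(z + ν)`. -/
def conjA (p₁ p₂ ν : ℕ) (z : ℂ) : ℂ := doubleEta p₁ p₂ (z + ν)

/-- The conjugate `B(z) = η(p₁z) η(p₂z) / (η(z) η(p₁p₂z))`. -/
def conjB (p₁ p₂ : ℕ) (z : ℂ) : ℂ :=
  ModularForm.eta (p₁ * z) * ModularForm.eta (p₂ * z) /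
    (ModularForm.eta z * ModularForm.eta (p₁ * p₂ * z))

/-- For `ν` prime to `p₂`, the integer `1 ≤ μ < p₂` with `μ ≡ -(ν p₁)⁻¹ mod p₂`. -/
def muIdx (p₁ p₂ ν : ℕ) : ℕ := ((-((ν : ZMod p₂) * (p₁ : ZMod p₂)))⁻¹).val

/-- The exponent `θ₂(ν)`, `0 ≤ ν < p₂`, for integers with `u p₁ + v p₂ = 1`. All divisions are
exact; `v₂ = (1 + p₁ μ ν) / p₂`. -/
def theta2 (p₁ p₂ : ℕ) (u v : ℤ) (ν : ℕ) : ℤ :=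
  if ν = 0 then
    if p₂ = 2 then (3 * u + 2) * (u - 1) / 2 else u * v * (p₂ + 1) + u - 1
  else
    if p₂ = 2 then (3 * p₁ + 2) * ((ν + 1) / 2)
    else muIdx p₁ p₂ ν * ((p₂ + 1) * ((1 + p₁ * muIdx p₁ p₂ ν * ν) / p₂) + 1) + ν

/-- The sign `ε₂`: the Legendre symbol `(p₁ / p₂)`, and `1` if `p₂ = 2`. -/
def eps2 (p₁ p₂ : ℕ) : ℤ := if p₂ = 2 then 1 else jacobiSym p₁ p₂

/-- The conjugate `C_{2,ν}(z)`, `0 ≤ ν < p₂`, for distinct primes `p₁`, `p₂`. The conjugate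
`C_{1,ν}` is the same expression with the indices `1` and `2` exchanged
(hence also `u` and `v`). -/
def conjC2 (p₁ p₂ : ℕ) (u v : ℤ) (ν : ℕ) (z : ℂ) : ℂ :=
  phi p₁ p₂ ^ theta2 p₁ p₂ u v ν * (eps2 p₁ p₂ : ℂ) *
    (ModularForm.eta (p₁ * (z + ν)) * ModularForm.eta ((z + ν) / p₂) /
      (ModularForm.eta (z + ν) * ModularForm.eta (p₁ * (z + ν) / p₂)))

/-- The exponent `θ(ν)`, `1 ≤ ν < p`, of the case `p₁ = p₂ = p`; here `1 = -μν + vp`, with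
`1 ≤ μ < p`. -/
def thetaEq (p ν : ℕ) : ℤ :=
  if p = 2 then 0
  else
    let μ : ℤ := muIdx 1 p ν
    let v : ℤ := (1 + μ * ν) / p
    p * ν * (1 - μ ^ 2) + (-3 * p + 2 + v) * μ - 3 + 3 * p

/-- The sign `ε(ν)`: the Legendre symbol `(-ν / p)`, and `1` if `p = 2`. -/
def epsEq (p ν : ℕ) : ℤ := if p = 2 then 1 else jacobiSym (-(ν : ℤ)) p

/-- The conjugate `C_ν(z) = √p ε(ν) ζ₂₄^θ(ν) η(pz)² / (η(z) η(z + ν/p))`, `1 ≤ ν < p`, of the case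
`p₁ = p₂ = p`. -/
def conjC (p ν : ℕ) (z : ℂ) : ℂ :=
  (Real.sqrt p : ℂ) * (epsEq p ν : ℂ) * zeta 24 ^ thetaEq p ν *
    (ModularForm.eta (p * z) ^ 2 / (ModularForm.eta z * ModularForm.eta (z + ν / p)))

/-- `A_ν' = χ^(α₀ - ν) A_ν^e`. -/
def conjA' (p₁ p₂ e δ ν : ℕ) (z : ℂ) : ℂ :=
  chi p₁ p₂ e ^ (alpha0 δ - ν) * conjA p₁ p₂ ν z ^ e

/-- `B' = B^e`. -/
def conjB' (p₁ p₂ e : ℕ) (z : ℂ) : ℂ := conjB p₁ p₂ z ^ e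

/-- `C_{2,ν}' = χ^(θ₂(ν) - ν) C_{2,ν}^e`. -/
def conjC2' (p₁ p₂ e : ℕ) (u v : ℤ) (ν : ℕ) (z : ℂ) : ℂ :=
  chi p₁ p₂ e ^ (theta2 p₁ p₂ u v ν - ν) * conjC2 p₁ p₂ u v ν z ^ e

/-- `C_{1,ν}' = χ^(θ₁(ν) - ν) C_{1,ν}^e`. -/
def conjC1' (p₁ p₂ e : ℕ) (u v : ℤ) (ν : ℕ) (z : ℂ) : ℂ := conjC2' p₂ p₁ e v u ν z

/-- `C_ν' = χ^μ C_ν^e` where `μ ≡ -1/ν mod p` (the case `p₁ = p₂ = p`). -/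
def conjC' (p e ν : ℕ) (z : ℂ) : ℂ := chi p p e ^ muIdx 1 p ν * conjC p ν z ^ e

/-- The values at `z` of all the (normalised) conjugates, with multiplicity: `B'`, the `A_ν'`, and
the `C_{1,ν}'` and `C_{2,ν}'` if `p₁ ≠ p₂`, respectively the `C_ν'` if `p₁ = p₂`. -/
def conjugates (p₁ p₂ e δ : ℕ) (u v : ℤ) (z : ℂ) : Multiset ℂ :=
  {conjB' p₁ p₂ e z} +
  (Multiset.range (p₁ * p₂)).map (fun ν => conjA' p₁ p₂ e δ ν z) +
  if p₁ = p₂ then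
    (Finset.Ico 1 p₁).val.map (fun ν => conjC' p₁ e ν z)
  else
    (Multiset.range p₁).map (fun ν => conjC1' p₁ p₂ e u v ν z) +
    (Multiset.range p₂).map (fun ν => conjC2' p₁ p₂ e u v ν z)

/-- The modular polynomial `Φ(F) = ∏ (F - conjugate)` at the point `z`. -/
def modPoly (p₁ p₂ e δ : ℕ) (u v : ℤ) (z : ℂ) : Polynomial ℂ :=
  ((conjugates p₁ p₂ e δ u v z).map (fun x => Polynomial.X - Polynomial.C x)).prod

/-- The trace: the sum of the conjugates at the point `z`. -/
def trace (p₁ p₂ e δ : ℕ) (u v : ℤ) (z : ℂ) : ℂ := (conjugates p₁ p₂ e δ u v z).sum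

/-- `s = ∑ s_x q^x` is the Puiseux expansion in `q = exp (2πiz)` of the function `f` on the upper
half-plane: the exponents have a common denominator and the series converges to `f` everywhere
(`q^x` stands for `exp (2πixz)`). -/
def IsPuiseuxExpansion (f : ℍ → ℂ) (s : HahnSeries ℚ ℂ) : Prop :=
  (∃ D : ℕ, 0 < D ∧ ∀ x ∈ s.support, ∃ m : ℤ, x = (m : ℚ) / (D : ℚ)) ∧
  ∀ z : ℍ, HasSum
    (fun x : ℚ => s.coeff x * Complex.exp (2 * Real.pi * Complex.I * (x : ℂ) * (z : ℂ))) (f z)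

end DoubleEta

end

/-! Writing `η(z) = q^(1/24) ∏ (1 - q^n)` turns every conjugate into a constant times a power of `q`
times the `e`-th power of a quotient of Euler products. With `D = 24 p₁ p₂`, such a quotient is a
holomorphic function of `q^(1/D)` on the unit disc with value 1 at 0. Hence `B'` has order `-re` and
leading coefficient 1, each `A_ν'` has order `-re/N`, the `C_{i,ν}'` have order `re/pᵢ`, and the
`C_ν'` have order `e(p - 1)/12`. Taylor expansion on the disc gives convergent Puiseux series.

For the trace, `B'` alone reaches the order `-re`. For (a), the constant term dominates in `X - f`
if `f` has a pole, and the `X`-term if `f` vanishes at `q = 0`. In the product a single coefficient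
is therefore dominant: its index is the number of conjugates of positive order, its order is the sum
of the negative orders, `-re - N · re/N`, and its leading coefficient is up to sign that of `∏
A_ν'`, a root of unity equal to `±1` (`prod_leadA_sq`).

The constant term of `Φ` is the product of all conjugates, their number being even. The powers of
`q` cancel, and so do the Euler products by the distribution relation `prod_eulerProd_root_mul`.
What remains is the product of the leading coefficients. For distinct odd primes the root of unity
equals the sign of quadratic reciprocity (`prod_leads_of_odd`). If one prime is 2, the symbol
`(2/p)` enters only through an `e`-th power equal to 1 (`prod_leads_of_two`). For equal odd primes
Wilson's theorem evaluates the product of the Legendre symbols, and the factors `√p` leave a power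
of `-p` (`prod_leads_of_eq`). -/

namespace DoubleEta

/-! ### The exponential and Euler's product -/

/-- `E z = exp (2πiz)`. -/
noncomputable def E (z : ℂ) : ℂ := Complex.exp (2 * Real.pi * Complex.I * z)

lemma E_add (x y : ℂ) : E (x + y) = E x * E y := by
  rw [E, mul_add, Complex.exp_add]; rfl

@[simp] lemma E_zero : E 0 = 1 := by simp [E]

lemma E_neg (x : ℂ) : E (-x) = (E x)⁻¹ := by
  rw [E, mul_neg, Complex.exp_neg]; rfl

lemma E_sub (x y : ℂ) : E (x - y) = E x / E y := by
  rw [sub_eq_add_neg, E_add, E_neg]; rfl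

lemma E_nat_mul (n : ℕ) (x : ℂ) : E (n * x) = E x ^ n := by
  rw [E, E, ← Complex.exp_nat_mul]; congr 1; ring

lemma E_int_mul (n : ℤ) (x : ℂ) : E (n * x) = E x ^ n := by
  rw [E, E, ← Complex.exp_int_mul]; congr 1; ring

lemma E_int (n : ℤ) : E n = 1 := by
  rw [E, Complex.exp_eq_one_iff]; exact ⟨n, by ring⟩

lemma E_nat (n : ℕ) : E n = 1 := by exact_mod_cast E_int n

lemma E_add_nat (z : ℂ) (n : ℕ) : E (z + n) = E z := by rw [E_add, E_nat, mul_one]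

lemma E_one_half : E (1 / 2) = -1 := by
  rw [E, ← Complex.exp_pi_mul_I]; congr 1; ring

lemma E_sum {ι : Type*} (s : Finset ι) (f : ι → ℂ) : E (∑ i ∈ s, f i) = ∏ i ∈ s, E (f i) := by
  induction s using Finset.cons_induction with
  | empty => simp
  | cons a s ha ih => rw [Finset.sum_cons, Finset.prod_cons, E_add, ih]

lemma norm_E (z : ℂ) : ‖E z‖ = Real.exp (-(2 * Real.pi * z.im)) := by
  rw [E, Complex.norm_exp]; congr 1; simp

lemma norm_E_lt_one {z : ℂ} (hz : 0 < z.im) : ‖E z‖ < 1 := by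
  rw [norm_E, Real.exp_lt_one_iff]
  have := Real.pi_pos
  simp only [Left.neg_neg_iff]; positivity

lemma norm_E_of_im_eq_zero {z : ℂ} (hz : z.im = 0) : ‖E z‖ = 1 := by
  rw [norm_E, hz]; simp

/-- Euler's product `∏ (1 - q ^ n)`, `n ≥ 1`. -/
noncomputable def eulerProd (q : ℂ) : ℂ := ∏' n : ℕ, (1 - q ^ (n + 1))

lemma eulerProd_zero : eulerProd 0 = 1 := by simp [eulerProd]

lemma eulerProd_ne_zero {q : ℂ} (hq : ‖q‖ < 1) : eulerProd q ≠ 0 := by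
  refine tprod_one_add_ne_zero_of_summable (f := fun n : ℕ => -q ^ (n + 1)) (fun n h => ?_) ?_
  · have h1 : q ^ (n + 1) = 1 := by linear_combination -h
    have h2 : ‖q‖ ^ (n + 1) = 1 := by rw [← norm_pow, h1, norm_one]
    have h3 := pow_lt_one₀ (norm_nonneg q) hq n.succ_ne_zero
    exact absurd h2 h3.ne
  · simpa using (summable_nat_add_iff 1).mpr (summable_geometric_of_lt_one (norm_nonneg _) hq)

lemma eta_eq (z : ℂ) : ModularForm.eta z = E (z / 24) * eulerProd (E z) := by
  simp only [ModularForm.eta, eulerProd, ModularForm.eta_q_eq_pow]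
  congr 1
  simp [Function.Periodic.qParam, E, mul_div_assoc]

/-! ### Functions with a leading term in `q^(1/D)` -/

/-- `f = q^(K/D) * H (q^(1/D))`, where `H` is holomorphic on the unit disc and `H 0 = c`. -/
def HasLead (D : ℕ) (f : ℍ → ℂ) (K : ℤ) (c : ℂ) : Prop :=
  ∃ H : ℂ → ℂ, DifferentiableOn ℂ H (Metric.ball 0 1) ∧ H 0 = c ∧
    ∀ z : ℍ, f z = E (K / D * z) * H (E (z / D))

namespace HasLead

variable {D : ℕ} {f g : ℍ → ℂ} {K L : ℤ} {c d : ℂ}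

lemma const (D : ℕ) (c : ℂ) : HasLead D (fun _ => c) 0 c :=
  ⟨fun _ => c, by fun_prop, rfl, fun z => by simp⟩

lemma zero (D : ℕ) (K : ℤ) : HasLead D (fun _ => 0) K 0 :=
  ⟨fun _ => 0, by fun_prop, rfl, fun z => by simp⟩

lemma exp (D : ℕ) (K : ℤ) : HasLead D (fun z => E (K / D * z)) K 1 :=
  ⟨fun _ => 1, by fun_prop, rfl, fun z => by simp⟩

lemma mul (hf : HasLead D f K c) (hg : HasLead D g L d) :
    HasLead D (fun z => f z * g z) (K + L) (c * d) := by
  obtain ⟨F, hF, hF0, hf⟩ := hf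
  obtain ⟨G, hG, hG0, hg⟩ := hg
  refine ⟨fun x => F x * G x, hF.mul hG, by simp only [hF0, hG0], fun z => ?_⟩
  simp only [hf, hg]
  rw [Int.cast_add, add_div, add_mul, E_add]; ring

lemma pow (hf : HasLead D f K c) (n : ℕ) : HasLead D (fun z => f z ^ n) (n * K) (c ^ n) := by
  induction n with
  | zero => simpa using const D 1
  | succ n ih => simpa only [pow_succ, Nat.cast_succ, add_mul, one_mul] using ih.mul hf

lemma add (hf : HasLead D f K c) (hg : HasLead D g K d) :
    HasLead D (fun z => f z + g z) K (c + d) := by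
  obtain ⟨F, hF, hF0, hf⟩ := hf
  obtain ⟨G, hG, hG0, hg⟩ := hg
  exact ⟨fun x => F x + G x, hF.add hG, by simp only [hF0, hG0], fun z => by simp only [hf, hg, mul_add]⟩

/-- The constant `c` may vanish, so `K` is only a lower bound for the order, and lowering it makes
the coefficient 0. This brings functions of different orders to a common exponent before `add` or
`sum`. -/
lemma of_lt (hf : HasLead D f K c) (h : L < K) : HasLead D f L 0 := by
  obtain ⟨F, hF, hF0, hf⟩ := hf
  obtain ⟨n, rfl⟩ := Int.le.dest h.le
  refine ⟨fun x => x ^ n * F x, by fun_prop, ?_, fun z => ?_⟩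
  · have hn : n ≠ 0 := by omega
    simp [hn]
  · rw [hf, ← mul_assoc, ← E_nat_mul, ← E_add]; congr 2; push_cast; ring

lemma sum {ι : Type*} (s : Finset ι) {f : ι → ℍ → ℂ} {c : ι → ℂ}
    (h : ∀ i ∈ s, HasLead D (f i) K (c i)) :
    HasLead D (fun z => ∑ i ∈ s, f i z) K (∑ i ∈ s, c i) := by
  induction s using Finset.cons_induction with
  | empty => simpa using zero D K
  | cons a s ha ih =>
    simp only [Finset.sum_cons]
    exact (h a (by simp)).add (ih fun i hi => h i (by simp [hi]))

/-- In terms of `x = q^(1/D)` the argument is `E b * x ^ m`. As `b` is real, `E b` has modulus 1 and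
the unit disc is mapped into itself; `0 < m` sends 0 to 0. -/
lemma eulerProd_comp {m : ℕ} (hm : 0 < m) {b : ℂ} (hb : b.im = 0) :
    HasLead D (fun z => eulerProd (E (m / D * z + b))) 0 1 := by
  refine ⟨fun x => eulerProd (E b * x ^ m), ?_, ?_, fun z => ?_⟩
  · refine ModularForm.differentiableOn_tprod_one_sub_pow.comp (by fun_prop) fun x hx => ?_
    rw [mem_ball_zero_iff] at hx ⊢
    rw [norm_mul, norm_E_of_im_eq_zero hb, one_mul, norm_pow]
    exact pow_lt_one₀ (norm_nonneg _) hx hm.ne'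
  · simp [hm.ne', eulerProd_zero]
  · simp only [← E_nat_mul, ← E_add, Int.cast_zero, zero_div, zero_mul, E_zero, one_mul]
    congr 2; ring

lemma eulerProd_comp_inv {m : ℕ} (hm : 0 < m) {b : ℂ} (hb : b.im = 0) :
    HasLead D (fun z => (eulerProd (E (m / D * z + b)))⁻¹) 0 1 := by
  have key : ∀ x ∈ Metric.ball (0 : ℂ) 1, E b * x ^ m ∈ Metric.ball (0 : ℂ) 1 := fun x hx => by
    rw [mem_ball_zero_iff] at hx ⊢
    rw [norm_mul, norm_E_of_im_eq_zero hb, one_mul, norm_pow]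
    exact pow_lt_one₀ (norm_nonneg _) hx hm.ne'
  refine ⟨fun x => (eulerProd (E b * x ^ m))⁻¹, ?_, ?_, fun z => ?_⟩
  · exact (ModularForm.differentiableOn_tprod_one_sub_pow.comp (by fun_prop) key).inv
      fun x hx => eulerProd_ne_zero (by simpa using key x hx)
  · simp [hm.ne', eulerProd_zero]
  · simp only [← E_nat_mul, ← E_add, Int.cast_zero, zero_div, zero_mul, E_zero, one_mul]
    congr 3; ring

/-- The Taylor series of `H` at 0 converges on the whole unit disc, hence at `q^(1/D)` for every
`z`. Its exponents are transported to `ℚ` by `n ↦ (K + n)/D`. -/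
lemma exists_puiseux (hD : 0 < D) (hf : HasLead D f K c) :
    ∃ s : HahnSeries ℚ ℂ, IsPuiseuxExpansion f s ∧ s.coeff (K / D) = c ∧
      ∀ x < (K / D : ℚ), s.coeff x = 0 := by
  obtain ⟨H, hH, hH0, hf⟩ := hf
  have hD' : (0 : ℚ) < D := by exact_mod_cast hD
  let φ : ℕ ↪o ℚ := OrderEmbedding.ofStrictMono (fun n => (K + n) / D : ℕ → ℚ) fun a b hab => by
    have : (a : ℚ) < b := by exact_mod_cast hab
    exact div_lt_div_of_pos_right (by linarith) hD'
  have hφ : ∀ n, φ n = (K + n) / D := fun n => rfl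
  let t : HahnSeries ℕ ℂ :=
    ⟨fun n => (n.factorial : ℂ)⁻¹ * iteratedDeriv n H 0, Set.isPWO_of_wellQuasiOrderedLE _⟩
  refine ⟨HahnSeries.embDomain φ t, ⟨⟨D, hD, fun x hx => ?_⟩, fun z => ?_⟩, ?_, fun x hx => ?_⟩
  · obtain ⟨n, -, rfl⟩ := HahnSeries.support_embDomain_subset hx
    exact ⟨K + n, by rw [hφ]; push_cast; rfl⟩
  · have hz : E (z / D) ∈ Metric.ball (0 : ℂ) 1 := by
      rw [mem_ball_zero_iff]
      refine norm_E_lt_one ?_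
      rw [Complex.div_natCast_im]
      have := z.im_pos
      exact div_pos this (by exact_mod_cast hD)
    have hs := (Complex.hasSum_taylorSeries_on_ball (r := 1) (by simpa using hH)
      (by simpa using hz)).mul_left (E (K / D * z))
    rw [hf, ← φ.injective.hasSum_iff (fun x hx => by
      rw [HahnSeries.embDomain_of_notMem_range hx, zero_mul])]
    refine hs.congr_fun fun n => ?_
    simp only [Function.comp_apply, HahnSeries.embDomain_coeff, sub_zero, smul_eq_mul, t]
    rw [← E_nat_mul, hφ]
    have : Complex.exp (2 * Real.pi * Complex.I * ((((K : ℚ) + n) / D : ℚ) : ℂ) * z) =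
        E (K / D * z) * E (n * (z / D)) := by
      rw [← E_add, E]; congr 1; push_cast; ring
    rw [this]; ring
  · have : (K / D : ℚ) = φ 0 := by rw [hφ]; simp
    rw [this, HahnSeries.embDomain_coeff]; simp [t, hH0]
  · refine HahnSeries.embDomain_of_notMem_range ?_
    rintro ⟨n, rfl⟩
    rw [hφ] at hx
    have := (div_lt_div_iff_of_pos_right hD').1 hx
    have h0 : (0 : ℚ) ≤ n := by positivity
    linarith

end HasLead

/-! ### Polynomials with one dominant coefficient -/

/-- The coefficient of `X ^ m` in the family `P` of polynomials is `c q^(K/D) + ⋯`, and all the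
other coefficients have order at least `(K + 1)/D`. -/
def DominantCoeff (D : ℕ) (P : ℍ → Polynomial ℂ) (m : ℕ) (K : ℤ) (c : ℂ) : Prop :=
  HasLead D (fun z => (P z).coeff m) K c ∧
    ∀ j, j ≠ m → ∃ d, HasLead D (fun z => (P z).coeff j) (K + 1) d

namespace DominantCoeff

open Polynomial

variable {D : ℕ} {P Q : ℍ → ℂ[X]} {m n : ℕ} {K L : ℤ} {c d : ℂ}

lemma one (D : ℕ) : DominantCoeff D (fun _ => 1) 0 0 1 := by
  refine ⟨by simpa using HasLead.const D 1, fun j hj => ⟨0, ?_⟩⟩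
  simpa [coeff_one, hj] using HasLead.zero D 1

/-- Among the products of a coefficient of `P` with one of `Q`, only the pair `(m, n)` can reach the
order `K + L`; all others lie at least one step of `1/D` higher. -/
lemma mul (hP : DominantCoeff D P m K c) (hQ : DominantCoeff D Q n L d) :
    DominantCoeff D (fun z => P z * Q z) (m + n) (K + L) (c * d) := by
  have key : ∀ i j, (i, j) ≠ (m, n) →
      ∃ b, HasLead D (fun z => (P z).coeff i * (Q z).coeff j) (K + L + 1) b := by
    intro i j hij
    by_cases hi : i = m
    · subst hi
      obtain ⟨b, hb⟩ := hQ.2 j (by simpa using hij)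
      exact ⟨_, by simpa only [add_assoc] using hP.1.mul hb⟩
    · obtain ⟨b, hb⟩ := hP.2 i hi
      by_cases hj : j = n
      · subst hj
        exact ⟨_, by simpa only [add_right_comm] using hb.mul hQ.1⟩
      · obtain ⟨b', hb'⟩ := hQ.2 j hj
        exact ⟨_, (hb.mul hb').of_lt (by omega)⟩
  choose! b hb using key
  simp only [DominantCoeff, coeff_mul]
  constructor
  · have hmem : (m, n) ∈ Finset.HasAntidiagonal.antidiagonal (m + n) := by simp
    simp only [← Finset.add_sum_erase _ _ hmem]
    have h := HasLead.sum (D := D) (K := K + L) ((Finset.HasAntidiagonal.antidiagonal (m + n)).erase (m, n))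
      (f := fun x z => (P z).coeff x.1 * (Q z).coeff x.2) (c := fun _ => 0)
      (fun x hx => (hb x.1 x.2 (Finset.ne_of_mem_erase hx)).of_lt (by omega))
    simpa using (hP.1.mul hQ.1).add h
  · intro j hj
    exact ⟨_, HasLead.sum (Finset.HasAntidiagonal.antidiagonal j)
      (f := fun x z => (P z).coeff x.1 * (Q z).coeff x.2) fun x hx => hb x.1 x.2 fun h => hj (by
        rw [Finset.HasAntidiagonal.mem_antidiagonal, show x = (m, n) from h] at hx; exact hx.symm)⟩

lemma prod {ι : Type*} (s : Finset ι) {P : ι → ℍ → ℂ[X]} {m : ι → ℕ} {K : ι → ℤ} {c : ι → ℂ}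
    (h : ∀ i ∈ s, DominantCoeff D (P i) (m i) (K i) (c i)) :
    DominantCoeff D (fun z => ∏ i ∈ s, P i z) (∑ i ∈ s, m i) (∑ i ∈ s, K i) (∏ i ∈ s, c i) := by
  induction s using Finset.cons_induction with
  | empty => simpa using one D
  | cons a s ha ih =>
    simp only [Finset.sum_cons, Finset.prod_cons]
    exact (h a (by simp)).mul (ih fun i hi => h i (by simp [hi]))

/-- A pole makes the constant term win over the coefficient 1 of `X`; since `K` is an integer, `K <
0` already gives the gap `K + 1 ≤ 0`. -/
lemma X_sub_C_of_neg {f : ℍ → ℂ} (hf : HasLead D f K c) (hK : K < 0) :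
    DominantCoeff D (fun z => X - C (f z)) 0 K (-c) := by
  refine ⟨by simpa using (HasLead.const D (-1)).mul hf, fun j hj => ?_⟩
  simp only [coeff_sub, coeff_X, coeff_C, hj, if_false, sub_zero]
  by_cases h1 : 1 = j
  · simp only [h1, if_true]
    rcases (show K + 1 ≤ 0 by omega).lt_or_eq with h | h
    · exact ⟨_, (HasLead.const D 1).of_lt h⟩
    · exact ⟨_, by rw [h]; exact HasLead.const D 1⟩
  · simp only [h1, if_false]
    exact ⟨_, HasLead.zero D _⟩

lemma X_sub_C_of_pos {f : ℍ → ℂ} (hf : HasLead D f K c) (hK : 0 < K) :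
    DominantCoeff D (fun z => X - C (f z)) 1 0 1 := by
  refine ⟨by simpa [coeff_X, coeff_C] using HasLead.const D 1, fun j hj => ?_⟩
  have h1 : ¬ 1 = j := fun h => hj h.symm
  simp only [coeff_sub, coeff_X, coeff_C, h1, if_false, zero_sub]
  by_cases h0 : j = 0
  · simp only [h0, if_true]
    have h := (HasLead.const D (-1)).mul hf
    simp only [zero_add, neg_one_mul] at h
    rcases (show 1 ≤ K by omega).lt_or_eq with h' | h'
    · exact ⟨_, h.of_lt h'⟩
    · exact ⟨_, by rw [zero_add, h']; exact h⟩
  · simp only [h0, if_false, neg_zero]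
    exact ⟨_, HasLead.zero D _⟩

end DominantCoeff

lemma orderTop_eq_and_leadingCoeff_eq {s : HahnSeries ℚ ℂ} {x : ℚ} {c : ℂ} (hc : c ≠ 0)
    (hx : s.coeff x = c) (hs : ∀ y < x, s.coeff y = 0) :
    s.orderTop = (x : WithTop ℚ) ∧ s.leadingCoeff = c := by
  have h : s.orderTop = (x : WithTop ℚ) := by
    refine HahnSeries.orderTop_eq_of_le (by simpa [hx] using hc) fun y hy => ?_
    by_contra! h
    exact hy (hs y h)
  refine ⟨h, ?_⟩
  rw [HahnSeries.leadingCoeff, h]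
  exact hx

end DoubleEta

/-! ### The distribution relation and the cancellation of Euler products -/

namespace DoubleEta

/-- Spreads `eulerProd r ^ k` over the multiples of `p`, with factors 1 elsewhere, so that Euler
products in different powers of `q` can be compared factor by factor. -/
lemma hasProd_ite_dvd {p : ℕ} (hp : 0 < p) (k : ℕ) {r : ℂ}
    (hr : ‖r‖ < 1) (f : ℕ → ℂ) (hf : ∀ m, f (p * (m + 1)) = (1 - r ^ (m + 1)) ^ k) :
    HasProd (fun n : ℕ => if p ∣ n + 1 then f (n + 1) else 1) (eulerProd r ^ k) := by
  -- The index `n` carries the exponent `n + 1`, so the multiple `p (m + 1)` sits at `p (m + 1) -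
  -- 1`.
  have hinj : Function.Injective fun m : ℕ => p * (m + 1) - 1 := by
    intro a b hab
    have ha : 0 < p * (a + 1) := by positivity
    have hb : 0 < p * (b + 1) := by positivity
    have : p * (a + 1) = p * (b + 1) := by simp only at hab; omega
    simpa [hp.ne'] using this
  rw [← hinj.hasProd_iff]
  · have h := ((ModularForm.multipliable_one_sub_pow hr).hasProd).pow k
    refine h.congr_fun fun m => ?_
    have ha : p * (m + 1) - 1 + 1 = p * (m + 1) := by
      have : 0 < p * (m + 1) := by positivity
      omega
    simp [ha, hf]
  · intro n hn
    rw [if_neg]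
    rintro ⟨m, hm⟩
    rcases m with _ | m
    · simp at hm
    · exact hn ⟨m, by simp only; omega⟩

lemma prod_one_sub_root_mul {p : ℕ} (hp : 0 < p) {ω : ℂ} (hω : IsPrimitiveRoot ω p) (y : ℂ) :
    ∏ ν ∈ Finset.range p, (1 - ω ^ ν * y) = 1 - y ^ p := by
  have := congrArg (Polynomial.eval 1) (X_pow_sub_C_eq_prod hω hp (α := y) rfl)
  simpa [Polynomial.eval_prod] using this.symm

/-- The distribution relation for Euler's product. -/
lemma prod_eulerProd_root_mul {p : ℕ} (hp : p.Prime) {ω : ℂ} (hω : IsPrimitiveRoot ω p) {x : ℂ}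
    (hx : ‖x‖ < 1) :
    (∏ ν ∈ Finset.range p, eulerProd (ω ^ ν * x)) * eulerProd ((x ^ p) ^ p) =
      eulerProd (x ^ p) ^ (p + 1) := by
  have hω1 : ‖ω‖ = 1 := hω.norm'_eq_one hp.ne_zero
  have hq : ‖x ^ p‖ < 1 := by
    rw [norm_pow]; exact pow_lt_one₀ (norm_nonneg _) hx hp.ne_zero
  have hqp : ‖(x ^ p) ^ p‖ < 1 := by
    rw [norm_pow]; exact pow_lt_one₀ (norm_nonneg _) hq hp.ne_zero
  have h1 : HasProd (fun n : ℕ => ∏ ν ∈ Finset.range p, (1 - (ω ^ ν * x) ^ (n + 1)))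
      (∏ ν ∈ Finset.range p, eulerProd (ω ^ ν * x)) :=
    hasProd_prod fun ν _ => (ModularForm.multipliable_one_sub_pow
      (by rw [norm_mul, norm_pow, hω1, one_pow, one_mul]; exact hx)).hasProd
  -- `h2` stretches `eulerProd ((x ^ p) ^ p)` and `h3` stretches `eulerProd (x ^ p) ^ p` over the
  -- multiples of `p`; afterwards both sides agree for each `n`.
  have h2 := hasProd_ite_dvd hp.pos 1 hqp
    (fun n => 1 - (x ^ p) ^ n) fun m => by rw [pow_mul, pow_one]
  have h3 := hasProd_ite_dvd hp.pos p hq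
    (fun n => (1 - x ^ n) ^ p) fun m => by rw [pow_mul]
  have h4 := (ModularForm.multipliable_one_sub_pow hq).hasProd.mul h3
  have h5 := h1.mul h2
  rw [pow_one] at h5
  rw [pow_succ', eulerProd]
  refine h5.unique ?_
  refine h4.congr_fun fun n => ?_
  by_cases hn : p ∣ n + 1
  · obtain ⟨m, hm⟩ := hn
    simp only [hm, dvd_mul_right, if_true]
    have : ∀ ν ∈ Finset.range p, 1 - (ω ^ ν * x) ^ (p * m) = 1 - x ^ (p * m) := fun ν _ => by
      rw [mul_pow, ← pow_mul, mul_left_comm, pow_mul ω p, hω.pow_eq_one, one_pow, one_mul]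
    rw [Finset.prod_congr rfl this, Finset.prod_const, Finset.card_range, mul_comm]
  · simp only [hn, if_false, mul_one]
    -- For `n + 1` prime to `p` the power `ω ^ (n + 1)` is again primitive, and the product over its
    -- powers collapses to `1 - x ^ (p (n + 1))`.
    have hc : (n + 1).Coprime p := ((Nat.Prime.coprime_iff_not_dvd hp).2 hn).symm
    rw [← pow_mul, mul_comm p, pow_mul, ← prod_one_sub_root_mul hp.pos (hω.pow_of_coprime _ hc)]
    refine Finset.prod_congr rfl fun ν _ => ?_
    rw [mul_pow, ← pow_mul, ← pow_mul, mul_comm ν]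

lemma prod_eulerProd_E {p a : ℕ} (hp : p.Prime) (ha : a.Coprime p) (ha0 : 0 < a) {z : ℂ}
    (hz : 0 < z.im) :
    (∏ ν ∈ Finset.range p, eulerProd (E (a * (z + ν) / p))) * eulerProd (E (p * (a * z))) =
      eulerProd (E (a * z)) ^ (p + 1) := by
  have hp0 : (p : ℂ) ≠ 0 := by exact_mod_cast hp.ne_zero
  have hω : IsPrimitiveRoot (E (a / p)) p := Complex.isPrimitiveRoot_exp_of_coprime a p hp.ne_zero ha
  have hx : ‖E (a * z / p)‖ < 1 := norm_E_lt_one (by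
    rw [Complex.div_natCast_im, ← nsmul_eq_mul, Complex.im_nsmul, nsmul_eq_mul]
    have : (0 : ℝ) < a := by exact_mod_cast ha0
    have : (0 : ℝ) < p := by exact_mod_cast hp.pos
    positivity)
  have h := prod_eulerProd_root_mul hp hω hx
  have h1 : E (a * z / p) ^ p = E (a * z) := by
    rw [← E_nat_mul]; congr 1; field_simp
  rw [h1, ← E_nat_mul] at h
  rw [← h]
  congr 1
  refine Finset.prod_congr rfl fun ν _ => ?_
  rw [← E_nat_mul, ← E_add]
  congr 2; field_simp; ring

lemma prod_range_mul_eq {M : Type*} [CommMonoid M] (m n : ℕ) (f : ℕ → M) :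
    ∏ ν ∈ Finset.range (m * n), f ν =
      ∏ j ∈ Finset.range m, ∏ i ∈ Finset.range n, f (j + m * i) := by
  rw [Finset.prod_comm]
  induction n with
  | zero => simp
  | succ n ih =>
    rw [mul_add_one, Finset.prod_range_add, ih, Finset.prod_range_succ]
    simp only [add_comm]

lemma prod_range_mul_of_periodic {M : Type*} [CommMonoid M] (m n : ℕ) (f : ℕ → M)
    (hf : ∀ j i, f (j + m * i) = f j) :
    ∏ ν ∈ Finset.range (m * n), f ν = (∏ j ∈ Finset.range m, f j) ^ n := by
  simp only [prod_range_mul_eq, hf, Finset.prod_const, Finset.card_range, Finset.prod_pow]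

variable {p₁ p₂ : ℕ} {z : ℂ}

/-- Euler products of the conjugate `A_ν`. -/
noncomputable def eulerA (p₁ p₂ ν : ℕ) (z : ℂ) : ℂ :=
  eulerProd (E ((z + ν) / p₁)) * eulerProd (E ((z + ν) / p₂)) /
    (eulerProd (E ((z + ν) / (p₁ * p₂))) * eulerProd (E (z + ν)))

/-- Euler products of the conjugate `B`. -/
noncomputable def eulerB (p₁ p₂ : ℕ) (z : ℂ) : ℂ :=
  eulerProd (E (p₁ * z)) * eulerProd (E (p₂ * z)) /
    (eulerProd (E z) * eulerProd (E (p₁ * p₂ * z)))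

/-- Euler products of the conjugate `C_{2,ν}`. -/
noncomputable def eulerC2 (p₁ p₂ ν : ℕ) (z : ℂ) : ℂ :=
  eulerProd (E (p₁ * (z + ν))) * eulerProd (E ((z + ν) / p₂)) /
    (eulerProd (E (z + ν)) * eulerProd (E (p₁ * (z + ν) / p₂)))

/-- Euler products of the conjugate `C_ν`. -/
noncomputable def eulerC (p ν : ℕ) (z : ℂ) : ℂ :=
  eulerProd (E (p * z)) ^ 2 / (eulerProd (E z) * eulerProd (E (z + ν / p)))

lemma eulerProd_E_ne_zero (hz : 0 < z.im) : eulerProd (E z) ≠ 0 :=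
  eulerProd_ne_zero (norm_E_lt_one hz)

lemma im_nat_mul_pos {n : ℕ} (hn : 0 < n) (hz : 0 < z.im) : 0 < ((n : ℂ) * z).im := by
  rw [← nsmul_eq_mul, Complex.im_nsmul, nsmul_eq_mul]
  have : (0 : ℝ) < n := by exact_mod_cast hn
  positivity

lemma im_div_nat_pos {n : ℕ} (hn : 0 < n) (hz : 0 < z.im) : 0 < (z / n).im := by
  rw [Complex.div_natCast_im]
  have : (0 : ℝ) < n := by exact_mod_cast hn
  positivity

lemma im_add_nat_pos (hz : 0 < z.im) (n : ℕ) : 0 < (z + n).im := by simpa using hz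

lemma prod_eulerProd_div (hp₁ : p₁.Prime) (hz : 0 < z.im) :
    (∏ ν ∈ Finset.range p₁, eulerProd (E ((z + ν) / p₁))) * eulerProd (E (p₁ * z)) =
      eulerProd (E z) ^ (p₁ + 1) := by
  simpa using prod_eulerProd_E (a := 1) hp₁ (by simp) one_pos hz

/-- Writing `ν = j + p₁ i` gives `(z + ν)/(p₁ p₂) = ((z + j)/p₁ + i)/p₂`, so the distribution
relation for `p₂` applies at each point `(z + j)/p₁`. -/
lemma prod_eulerProd_div_mul (hp₁ : p₁.Prime) (hp₂ : p₂.Prime) (hz : 0 < z.im) :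
    (∏ ν ∈ Finset.range (p₁ * p₂), eulerProd (E ((z + ν) / (p₁ * p₂)))) *
        ∏ ν ∈ Finset.range p₁, eulerProd (E (p₂ * (z + ν) / p₁)) =
      (∏ ν ∈ Finset.range p₁, eulerProd (E ((z + ν) / p₁))) ^ (p₂ + 1) := by
  have h1 : (p₁ : ℂ) ≠ 0 := by exact_mod_cast hp₁.ne_zero
  have h2 : (p₂ : ℂ) ≠ 0 := by exact_mod_cast hp₂.ne_zero
  rw [prod_range_mul_eq, ← Finset.prod_mul_distrib, ← Finset.prod_pow]
  refine Finset.prod_congr rfl fun j _ => ?_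
  rw [← prod_eulerProd_div hp₂ (im_div_nat_pos hp₁.pos (im_add_nat_pos hz j))]
  congr 1
  · refine Finset.prod_congr rfl fun i _ => ?_
    congr 2; push_cast; field_simp; ring
  · congr 2; ring

lemma prod_eulerA (hp₁ : p₁.Prime) (hp₂ : p₂.Prime) (z : ℂ) :
    ∏ ν ∈ Finset.range (p₁ * p₂), eulerA p₁ p₂ ν z =
      (∏ ν ∈ Finset.range p₁, eulerProd (E ((z + ν) / p₁))) ^ p₂ *
        (∏ ν ∈ Finset.range p₂, eulerProd (E ((z + ν) / p₂))) ^ p₁ /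
        ((∏ ν ∈ Finset.range (p₁ * p₂), eulerProd (E ((z + ν) / (p₁ * p₂)))) *
          eulerProd (E z) ^ (p₁ * p₂)) := by
  have per : ∀ {p : ℕ}, p.Prime → ∀ j i : ℕ,
      eulerProd (E ((z + (j + p * i : ℕ)) / p)) = eulerProd (E ((z + j) / p)) := by
    intro p hp j i
    have h1 : (p : ℂ) ≠ 0 := by exact_mod_cast hp.ne_zero
    rw [← E_add_nat ((z + j) / p) i]
    congr 2; push_cast; field_simp; ring
  simp only [eulerA, Finset.prod_div_distrib, Finset.prod_mul_distrib, E_add_nat,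
    Finset.prod_const, Finset.card_range]
  rw [prod_range_mul_of_periodic p₁ p₂ _ (per hp₁)]
  have h := prod_range_mul_of_periodic p₂ p₁ (fun ν => eulerProd (E ((z + ν) / p₂))) (per hp₂)
  rw [mul_comm p₂] at h
  rw [h]

/-- The `A`-part contributes a second copy of the `B`-part; by `prod_eulerC2` each of the two
`C`-families contributes an inverse copy, so everything cancels. -/
lemma prod_eulerA_of_ne (hp₁ : p₁.Prime) (hp₂ : p₂.Prime) (hne : p₁ ≠ p₂) (hz : 0 < z.im) :
    ∏ ν ∈ Finset.range (p₁ * p₂), eulerA p₁ p₂ ν z = eulerB p₁ p₂ z := by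
  have h1 := prod_eulerProd_div hp₁ hz
  have h2 := prod_eulerProd_div hp₂ hz
  have h3 := prod_eulerProd_div_mul hp₁ hp₂ hz
  have h4 := prod_eulerProd_E hp₁ ((Nat.coprime_primes hp₂ hp₁).2 hne.symm) hp₂.pos hz
  have e1 := eulerProd_E_ne_zero hz
  have e2 := eulerProd_E_ne_zero (im_nat_mul_pos hp₁.pos hz)
  have e3 := eulerProd_E_ne_zero (im_nat_mul_pos hp₂.pos hz)
  have e4 := eulerProd_E_ne_zero (im_nat_mul_pos hp₁.pos (im_nat_mul_pos hp₂.pos hz))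
  rw [prod_eulerA hp₁ hp₂ z, eulerB, mul_assoc (p₁ : ℂ)]
  rw [← eq_div_iff e2] at h1
  rw [← eq_div_iff e3] at h2
  rw [← eq_div_iff e4] at h4
  rw [h4, ← eq_div_iff (by positivity)] at h3
  rw [h3, h1, h2]
  clear h1 h2 h3 h4
  generalize eulerProd (E z) = a at *
  generalize eulerProd (E (p₁ * z)) = a₁ at *
  generalize eulerProd (E (p₂ * z)) = a₂ at *
  generalize eulerProd (E (p₁ * (p₂ * z))) = b at *
  simp only [div_pow]
  field_simp
  ring

lemma prod_eulerC2 (hp₁ : p₁.Prime) (hp₂ : p₂.Prime) (hne : p₁ ≠ p₂) (hz : 0 < z.im) :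
    ∏ ν ∈ Finset.range p₂, eulerC2 p₁ p₂ ν z = (eulerB p₁ p₂ z)⁻¹ := by
  have h2 := prod_eulerProd_div hp₂ hz
  have h4 := prod_eulerProd_E hp₂ ((Nat.coprime_primes hp₁ hp₂).2 hne) hp₁.pos hz
  have e1 := eulerProd_E_ne_zero hz
  have e2 := eulerProd_E_ne_zero (im_nat_mul_pos hp₁.pos hz)
  have e3 := eulerProd_E_ne_zero (im_nat_mul_pos hp₂.pos hz)
  have e4 := eulerProd_E_ne_zero (im_nat_mul_pos hp₂.pos (im_nat_mul_pos hp₁.pos hz))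
  have per : ∀ ν : ℕ, E (p₁ * (z + ν)) = E (p₁ * z) := fun ν => by
    rw [← E_add_nat (p₁ * z) (p₁ * ν)]; congr 1; push_cast; ring
  rw [← eq_div_iff e3] at h2
  rw [← eq_div_iff e4] at h4
  simp only [eulerC2, Finset.prod_div_distrib, Finset.prod_mul_distrib, E_add_nat, per,
    Finset.prod_const, Finset.card_range]
  rw [h2, h4, eulerB, mul_comm (p₁ : ℂ) p₂, mul_assoc (p₂ : ℂ)]
  generalize eulerProd (E z) = a at *
  generalize eulerProd (E (p₁ * z)) = a₁ at *
  generalize eulerProd (E (p₂ * z)) = a₂ at *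
  generalize eulerProd (E (p₂ * (p₁ * z))) = b at *
  field_simp
  ring

lemma prod_eulerA_mul_prod_eulerC {p : ℕ} (hp : p.Prime) (hz : 0 < z.im) :
    eulerB p p z * (∏ ν ∈ Finset.range (p * p), eulerA p p ν z) *
      ∏ ν ∈ Finset.Ico 1 p, eulerC p ν z = 1 := by
  have hp0 : (p : ℂ) ≠ 0 := by exact_mod_cast hp.ne_zero
  have hz' := im_nat_mul_pos hp.pos hz
  have h1 := prod_eulerProd_div hp hz
  have h3 := prod_eulerProd_div_mul hp hp hz
  have h5 := prod_eulerProd_div hp hz'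
  have e1 := eulerProd_E_ne_zero hz
  have e2 := eulerProd_E_ne_zero hz'
  have e4 := eulerProd_E_ne_zero (im_nat_mul_pos hp.pos hz')
  have h4 : ∏ ν ∈ Finset.range p, eulerProd (E (p * (z + ν) / p)) = eulerProd (E z) ^ p := by
    rw [Finset.prod_congr rfl fun ν _ => by rw [mul_div_cancel_left₀ _ hp0, E_add_nat],
      Finset.prod_const, Finset.card_range]
  -- The missing index `ν = 0` is supplied by `eulerProd (E z)`; the full product is then the
  -- distribution relation at `p z`.
  have h6 : (eulerProd (E z) * ∏ ν ∈ Finset.Ico 1 p, eulerProd (E (z + ν / p))) =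
      ∏ ν ∈ Finset.range p, eulerProd (E ((p * z + ν) / p)) := by
    rw [Finset.range_eq_Ico, Finset.prod_eq_prod_Ico_succ_bot hp.pos]
    simp only [add_div, mul_div_cancel_left₀ _ hp0]
    simp
  rw [prod_eulerA hp hp z, eulerB, mul_assoc (p : ℂ)]
  simp only [eulerC, Finset.prod_div_distrib, Finset.prod_mul_distrib, Finset.prod_const,
    Nat.card_Ico]
  rw [← h6, mul_comm (eulerProd (E z)), mul_assoc, ← eq_div_iff (mul_ne_zero e1 e4)] at h5
  rw [← eq_div_iff e2] at h1
  rw [h4, ← eq_div_iff (by positivity)] at h3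
  rw [h3, h1, h5]
  clear h1 h3 h4 h5 h6
  generalize eulerProd (E z) = a at *
  generalize eulerProd (E (p * z)) = a₁ at *
  generalize eulerProd (E (p * (p * z))) = b at *
  obtain ⟨k, rfl⟩ : ∃ k, p = k + 1 := ⟨p - 1, by have := hp.pos; omega⟩
  rw [Nat.add_sub_cancel]
  simp only [div_pow]
  field_simp
  ring

end DoubleEta

/-! ### Leading coefficients and orders of the conjugates -/

namespace DoubleEta

/-- The order `re` of the pole of the trace, as a complex number. -/
noncomputable def rho (p₁ p₂ e : ℕ) : ℂ := e * ((p₁ - 1) * (p₂ - 1)) / 24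

lemma rho_comm (p₁ p₂ e : ℕ) : rho p₁ p₂ e = rho p₂ p₁ e := by
  rw [rho, rho, mul_comm ((p₁ : ℂ) - 1)]

lemma zeta_eq (n : ℕ) : zeta n = E (1 / n) := by
  rw [zeta, E]; congr 1; ring

variable {p₁ p₂ e : ℕ}

lemma phi_eq (hp₁ : 0 < p₁) (hp₂ : 0 < p₂) :
    phi p₁ p₂ = E ((p₁ - 1) * (p₂ - 1) / 24) := by
  rw [phi, zeta_eq, ← E_nat_mul]
  congr 1
  push_cast [Nat.cast_sub hp₁, Nat.cast_sub hp₂]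
  ring

lemma chi_eq (hp₁ : 0 < p₁) (hp₂ : 0 < p₂) : chi p₁ p₂ e = E (-rho p₁ p₂ e) := by
  rw [chi, phi_eq hp₁ hp₂, ← E_int_mul, rho]
  congr 1; push_cast; ring

lemma conjB'_eq (z : ℂ) : conjB' p₁ p₂ e z = E (-rho p₁ p₂ e * z) * eulerB p₁ p₂ z ^ e := by
  have h : E (-((p₁ - 1) * (p₂ - 1)) / 24 * z) =
      E (p₁ * z / 24) * E (p₂ * z / 24) / (E (z / 24) * E (p₁ * p₂ * z / 24)) := by
    rw [← E_add, ← E_add, ← E_sub]; congr 1; ring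
  have h' : E (-rho p₁ p₂ e * z) = E (-((p₁ - 1) * (p₂ - 1)) / 24 * z) ^ e := by
    rw [← E_nat_mul, rho]; congr 1; ring
  rw [conjB', conjB, h', ← mul_pow, h]
  simp only [eta_eq, eulerB]
  congr 1
  rw [div_mul_div_comm]; congr 1 <;> ring

/-- The leading coefficient of `A_ν'`. -/
noncomputable def leadA (p₁ p₂ e δ ν : ℕ) : ℂ :=
  E (-rho p₁ p₂ e * (alpha0 δ - ν + ν / (p₁ * p₂)))

lemma conjA'_eq (hp₁ : 0 < p₁) (hp₂ : 0 < p₂) (δ ν : ℕ) (z : ℂ) :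
    conjA' p₁ p₂ e δ ν z =
      leadA p₁ p₂ e δ ν * E (-rho p₁ p₂ e / (p₁ * p₂) * z) * eulerA p₁ p₂ ν z ^ e := by
  have h1 : (p₁ : ℂ) ≠ 0 := by exact_mod_cast hp₁.ne'
  have h2 : (p₂ : ℂ) ≠ 0 := by exact_mod_cast hp₂.ne'
  have h : E (-((p₁ - 1) * (p₂ - 1)) / 24 / (p₁ * p₂) * (z + ν)) =
      E ((z + ν) / p₁ / 24) * E ((z + ν) / p₂ / 24) /
        (E ((z + ν) / (p₁ * p₂) / 24) * E ((z + ν) / 24)) := by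
    rw [← E_add, ← E_add, ← E_sub]; congr 1; field_simp; ring
  have h' : leadA p₁ p₂ e δ ν * E (-rho p₁ p₂ e / (p₁ * p₂) * z) =
      E (-rho p₁ p₂ e) ^ (alpha0 δ - ν) *
        E (-((p₁ - 1) * (p₂ - 1)) / 24 / (p₁ * p₂) * (z + ν)) ^ e := by
    rw [← E_nat_mul, ← E_int_mul, leadA, ← E_add, ← E_add, rho]; congr 1; push_cast; ring
  rw [conjA', conjA, doubleEta, h', chi_eq hp₁ hp₂, mul_assoc, ← mul_pow, h]
  simp only [eta_eq, eulerA]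
  congr 2
  rw [div_mul_div_comm]; congr 1 <;> ring

/-- The leading coefficient of `C_{2,ν}'`. -/
noncomputable def leadC2 (p₁ p₂ e ν : ℕ) : ℂ :=
  (eps2 p₁ p₂ : ℂ) ^ e * E (rho p₁ p₂ e * (ν + ν / p₂))

/-- Since `χ = φ ^ (-e)`, the factor `χ ^ (θ₂(ν) - ν)` cancels `φ ^ (e θ₂(ν))` up to `φ ^ (e ν)`, so
`theta2` does not appear in `leadC2`. -/
lemma conjC2'_eq (hp₁ : 0 < p₁) (hp₂ : 0 < p₂) (u v : ℤ) (ν : ℕ) (z : ℂ) :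
    conjC2' p₁ p₂ e u v ν z =
      leadC2 p₁ p₂ e ν * E (rho p₁ p₂ e / p₂ * z) * eulerC2 p₁ p₂ ν z ^ e := by
  have h2 : (p₂ : ℂ) ≠ 0 := by exact_mod_cast hp₂.ne'
  have h : E ((p₁ - 1) * (p₂ - 1) / 24 / p₂ * (z + ν)) =
      E (p₁ * (z + ν) / 24) * E ((z + ν) / p₂ / 24) /
        (E ((z + ν) / 24) * E (p₁ * (z + ν) / p₂ / 24)) := by
    rw [← E_add, ← E_add, ← E_sub]; congr 1; field_simp; ring
  have h' : E (rho p₁ p₂ e * (ν + ν / p₂)) * E (rho p₁ p₂ e / p₂ * z) =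
      E (-rho p₁ p₂ e) ^ (theta2 p₁ p₂ u v ν - ν) *
        (E ((p₁ - 1) * (p₂ - 1) / 24) ^ theta2 p₁ p₂ u v ν) ^ e *
        E ((p₁ - 1) * (p₂ - 1) / 24 / p₂ * (z + ν)) ^ e := by
    simp only [← E_nat_mul, ← E_int_mul, ← E_add, rho]; congr 1; push_cast; ring
  rw [leadC2, mul_assoc (_ ^ e), h', conjC2', conjC2, chi_eq hp₁ hp₂, phi_eq hp₁ hp₂, h]
  simp only [eta_eq, eulerC2, mul_pow, div_pow]
  ring

/-- The leading coefficient of `C_ν'`. -/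
noncomputable def leadC (p e ν : ℕ) : ℂ :=
  ((Real.sqrt p : ℂ) * epsEq p ν) ^ e *
    E (-rho p p e * muIdx 1 p ν + e * (thetaEq p ν - ν / p) / 24)

lemma conjC'_eq {p : ℕ} (hp : 0 < p) (ν : ℕ) (z : ℂ) :
    conjC' p e ν z = leadC p e ν * E (e * (p - 1) / 12 * z) * eulerC p ν z ^ e := by
  have h : E ((p - 1) / 12 * z - ν / p / 24) =
      E (p * z / 24) ^ 2 / (E (z / 24) * E ((z + ν / p) / 24)) := by
    rw [← E_add, ← E_nat_mul, ← E_sub]; congr 1; push_cast; ring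
  have h' : E (-rho p p e * muIdx 1 p ν + e * (thetaEq p ν - ν / p) / 24) *
      E (e * (p - 1) / 12 * z) =
      E (-rho p p e) ^ muIdx 1 p ν * (E (1 / (24 : ℕ)) ^ thetaEq p ν) ^ e *
        E ((p - 1) / 12 * z - ν / p / 24) ^ e := by
    simp only [← E_nat_mul, ← E_int_mul, ← E_add]; congr 1; push_cast; ring
  rw [leadC, mul_assoc (_ ^ e), h', conjC', conjC, chi_eq hp hp, zeta_eq, h]
  simp only [eta_eq, eulerC, mul_pow, div_pow]
  ring

lemma hasLead_eulerA (hp₁ : 0 < p₁) (hp₂ : 0 < p₂) (ν : ℕ) :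
    HasLead (24 * (p₁ * p₂)) (fun z => eulerA p₁ p₂ ν z) 0 1 := by
  have h1 : (p₁ : ℂ) ≠ 0 := by exact_mod_cast hp₁.ne'
  have h2 : (p₂ : ℂ) ≠ 0 := by exact_mod_cast hp₂.ne'
  -- Each `m` is the coefficient of `z` in the argument times `D`: here `1/p₁ = 24 p₂ / D`.
  have i1 := HasLead.eulerProd_comp (D := 24 * (p₁ * p₂)) (m := 24 * p₂) (b := (ν : ℂ) / p₁)
    (by positivity) (by simp)
  have i2 := HasLead.eulerProd_comp (D := 24 * (p₁ * p₂)) (m := 24 * p₁) (b := (ν : ℂ) / p₂)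
    (by positivity) (by simp)
  have i3 := HasLead.eulerProd_comp_inv (D := 24 * (p₁ * p₂)) (m := 24)
    (b := (ν : ℂ) / ((p₁ * p₂ : ℕ) : ℂ)) (by positivity) (by rw [Complex.div_natCast_im]; simp)
  have i4 := HasLead.eulerProd_comp_inv (D := 24 * (p₁ * p₂)) (m := 24 * (p₁ * p₂)) (b := (ν : ℂ))
    (by positivity) (by simp)
  convert (i1.mul i2).mul (i3.mul i4) using 1
  · funext z
    rw [eulerA, ← mul_inv, ← div_eq_mul_inv]
    congr 4 <;> congr 1 <;> push_cast <;> field_simp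
  · simp
  · simp

lemma hasLead_eulerB (hp₁ : 0 < p₁) (hp₂ : 0 < p₂) :
    HasLead (24 * (p₁ * p₂)) (fun z => eulerB p₁ p₂ z) 0 1 := by
  have h1 : (p₁ : ℂ) ≠ 0 := by exact_mod_cast hp₁.ne'
  have h2 : (p₂ : ℂ) ≠ 0 := by exact_mod_cast hp₂.ne'
  have i1 := HasLead.eulerProd_comp (D := 24 * (p₁ * p₂)) (m := 24 * (p₁ * p₂) * p₁) (b := 0)
    (by positivity) (by simp)
  have i2 := HasLead.eulerProd_comp (D := 24 * (p₁ * p₂)) (m := 24 * (p₁ * p₂) * p₂) (b := 0)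
    (by positivity) (by simp)
  have i3 := HasLead.eulerProd_comp_inv (D := 24 * (p₁ * p₂)) (m := 24 * (p₁ * p₂)) (b := 0)
    (by positivity) (by simp)
  have i4 := HasLead.eulerProd_comp_inv (D := 24 * (p₁ * p₂)) (m := 24 * (p₁ * p₂) * (p₁ * p₂))
    (b := 0) (by positivity) (by simp)
  convert (i1.mul i2).mul (i3.mul i4) using 1
  · funext z
    rw [eulerB, ← mul_inv, ← div_eq_mul_inv]
    congr 5 <;> push_cast <;> field_simp <;> simp
  · simp
  · simp

lemma hasLead_eulerC2 (hp₁ : 0 < p₁) (hp₂ : 0 < p₂) (ν : ℕ) :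
    HasLead (24 * (p₁ * p₂)) (fun z => eulerC2 p₁ p₂ ν z) 0 1 := by
  have h1 : (p₁ : ℂ) ≠ 0 := by exact_mod_cast hp₁.ne'
  have h2 : (p₂ : ℂ) ≠ 0 := by exact_mod_cast hp₂.ne'
  have i1 := HasLead.eulerProd_comp (D := 24 * (p₁ * p₂)) (m := 24 * (p₁ * p₂) * p₁)
    (b := (p₁ * ν : ℕ)) (by positivity) (by simp)
  have i2 := HasLead.eulerProd_comp (D := 24 * (p₁ * p₂)) (m := 24 * p₁) (b := (ν : ℂ) / p₂)
    (by positivity) (by simp)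
  have i3 := HasLead.eulerProd_comp_inv (D := 24 * (p₁ * p₂)) (m := 24 * (p₁ * p₂)) (b := (ν : ℂ))
    (by positivity) (by simp)
  have i4 := HasLead.eulerProd_comp_inv (D := 24 * (p₁ * p₂)) (m := 24 * p₁ * p₁)
    (b := ((p₁ * ν : ℕ) : ℂ) / p₂) (by positivity) (by simp)
  convert (i1.mul i2).mul (i3.mul i4) using 1
  · funext z
    rw [eulerC2, ← mul_inv, ← div_eq_mul_inv]
    congr 4 <;> congr 1 <;> push_cast <;> field_simp
  · simp
  · simp

lemma hasLead_eulerC {p : ℕ} (hp : 0 < p) (ν : ℕ) :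
    HasLead (24 * (p * p)) (fun z => eulerC p ν z) 0 1 := by
  have h1 : (p : ℂ) ≠ 0 := by exact_mod_cast hp.ne'
  have i1 := HasLead.eulerProd_comp (D := 24 * (p * p)) (m := 24 * (p * p) * p)
    (b := 0) (by positivity) (by simp)
  have i3 := HasLead.eulerProd_comp_inv (D := 24 * (p * p)) (m := 24 * (p * p)) (b := 0)
    (by positivity) (by simp)
  have i4 := HasLead.eulerProd_comp_inv (D := 24 * (p * p)) (m := 24 * (p * p))
    (b := (ν : ℂ) / p) (by positivity) (by simp)
  convert (i1.mul i1).mul (i3.mul i4) using 1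
  · funext z
    rw [eulerC, ← mul_inv, ← div_eq_mul_inv, ← pow_two]
    congr 4 <;> congr 1 <;> push_cast <;> field_simp <;> simp
  · simp
  · simp

lemma hasLead_of_eq {D : ℕ} {f g : ℍ → ℂ} {a c : ℂ} {K : ℤ} (hg : HasLead D g 0 1) (ha : a = K / D)
    (h : ∀ z : ℍ, f z = c * E (a * z) * g z ^ e) : HasLead D f K c := by
  have := ((HasLead.const D c).mul (HasLead.exp D K)).mul (hg.pow e)
  simp only [zero_add, mul_zero, add_zero, one_pow, mul_one, ← ha, ← h] at this
  exact this

lemma hasLead_conjB' (hp₁ : 0 < p₁) (hp₂ : 0 < p₂) :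
    HasLead (24 * (p₁ * p₂)) (fun z => conjB' p₁ p₂ e z)
      (-(e * ((p₁ - 1) * (p₂ - 1)) * (p₁ * p₂))) 1 := by
  have h1 : (p₁ : ℂ) ≠ 0 := by exact_mod_cast hp₁.ne'
  have h2 : (p₂ : ℂ) ≠ 0 := by exact_mod_cast hp₂.ne'
  refine hasLead_of_eq (hasLead_eulerB hp₁ hp₂) ?_ fun z => by rw [conjB'_eq, one_mul]
  rw [rho]; push_cast; field_simp

lemma hasLead_conjA' (hp₁ : 0 < p₁) (hp₂ : 0 < p₂) (δ ν : ℕ) :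
    HasLead (24 * (p₁ * p₂)) (fun z => conjA' p₁ p₂ e δ ν z)
      (-(e * ((p₁ - 1) * (p₂ - 1)))) (leadA p₁ p₂ e δ ν) := by
  have h1 : (p₁ : ℂ) ≠ 0 := by exact_mod_cast hp₁.ne'
  have h2 : (p₂ : ℂ) ≠ 0 := by exact_mod_cast hp₂.ne'
  refine hasLead_of_eq (hasLead_eulerA hp₁ hp₂ ν) ?_ fun z => conjA'_eq hp₁ hp₂ δ ν z
  rw [rho]; push_cast; field_simp

lemma hasLead_conjC2' (hp₁ : 0 < p₁) (hp₂ : 0 < p₂) (u v : ℤ) (ν : ℕ) :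
    HasLead (24 * (p₁ * p₂)) (fun z => conjC2' p₁ p₂ e u v ν z)
      (e * ((p₁ - 1) * (p₂ - 1)) * p₁) (leadC2 p₁ p₂ e ν) := by
  have h1 : (p₁ : ℂ) ≠ 0 := by exact_mod_cast hp₁.ne'
  have h2 : (p₂ : ℂ) ≠ 0 := by exact_mod_cast hp₂.ne'
  refine hasLead_of_eq (hasLead_eulerC2 hp₁ hp₂ ν) ?_ fun z => conjC2'_eq hp₁ hp₂ u v ν z
  rw [rho]; push_cast; field_simp

lemma hasLead_conjC' {p : ℕ} (hp : 0 < p) (ν : ℕ) :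
    HasLead (24 * (p * p)) (fun z => conjC' p e ν z)
      (2 * e * (p - 1) * p ^ 2) (leadC p e ν) := by
  have h1 : (p : ℂ) ≠ 0 := by exact_mod_cast hp.ne'
  exact hasLead_of_eq (hasLead_eulerC hp ν) (by push_cast; field_simp; ring)
    fun z => conjC'_eq hp ν z

end DoubleEta

/-! ### Arithmetic of the admissible parameters -/

namespace DoubleEta

variable {p₁ p₂ e δ : ℕ}

/-- Since `δ` divides 12, everything depends only on the residues modulo 12. In `fin`, `rᵢ` is the
residue of `pᵢ - 1`, and the conditions on the `rᵢ` are decided row by row. -/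
lemma IsTableRow.facts (h : IsTableRow p₁ p₂ e δ) :
    0 < e ∧ (δ = 2 ∨ δ = 3 ∨ δ = 6) ∧ p₁ * p₂ ≡ 1 [MOD δ] ∧
      24 ∣ δ * (e * ((p₁ - 1) * (p₂ - 1))) ∧ (p₁ = 2 → Even e) ∧ (p₂ = 2 → Even e) ∧
      (p₁ = 2 → p₂ = 2 → e = 8) := by
  have key : ∀ {p r : ℕ}, p % 12 = r → ∃ k, p = 12 * k + r := fun {p r} h =>
    ⟨p / 12, by omega⟩
  have fin : ∀ {p₁ p₂ e δ r₁ r₂ k₁ k₂ : ℕ}, p₁ = 12 * k₁ + r₁ + 1 → p₂ = 12 * k₂ + r₂ + 1 →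
      2 < p₂ → 0 < e → (δ = 2 ∨ δ = 3 ∨ δ = 6) → (r₁ + 1) * (r₂ + 1) ≡ 1 [MOD δ] →
      24 ∣ δ * e * 12 * r₁ → 24 ∣ δ * e * 12 * r₂ → 24 ∣ δ * e * (r₁ * r₂) →
      (p₁ = 2 → Even e) →
      0 < e ∧ (δ = 2 ∨ δ = 3 ∨ δ = 6) ∧ p₁ * p₂ ≡ 1 [MOD δ] ∧
      24 ∣ δ * (e * ((p₁ - 1) * (p₂ - 1))) ∧ (p₁ = 2 → Even e) ∧ (p₂ = 2 → Even e) ∧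
      (p₁ = 2 → p₂ = 2 → e = 8) := by
    intro p₁ p₂ e δ r₁ r₂ k₁ k₂ h₁ h₂ hp he hδ hN d₁ d₂ d₃ h2
    refine ⟨he, hδ, ?_, ?_, h2, by omega, by omega⟩
    · have hδ12 : δ ∣ 12 := by rcases hδ with rfl | rfl | rfl <;> norm_num
      have aux : ∀ k r, 12 * k + r + 1 ≡ r + 1 [MOD δ] := fun k r => by
        have : 12 * k ≡ 0 [MOD δ] := (Nat.modEq_zero_iff_dvd).2 (hδ12.mul_right k)
        simpa [add_assoc] using this.add_right (r + 1)
      rw [h₁, h₂]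
      exact ((aux _ _).mul (aux _ _)).trans hN
    · rw [h₁, h₂, Nat.add_sub_cancel, Nat.add_sub_cancel]
      have : δ * (e * ((12 * k₁ + r₁) * (12 * k₂ + r₂))) =
          24 * (6 * (δ * e * k₁ * k₂)) + δ * e * 12 * r₂ * k₁ + δ * e * 12 * r₁ * k₂ +
            δ * e * (r₁ * r₂) := by ring
      rw [this]
      exact (((dvd_mul_right _ _).add (d₂.mul_right _)).add (d₁.mul_right _)).add d₃
  rcases h with ⟨h1, h2, rfl, rfl⟩ | ⟨h1, h2, rfl, rfl⟩ | ⟨h1, h2, rfl, rfl⟩ | ⟨h1, h2, rfl, rfl⟩ |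
    ⟨h1, h2, rfl, rfl⟩ | ⟨h1, h2, rfl, rfl⟩ | ⟨h1, h2, rfl, rfl⟩ | ⟨h1, h2, rfl, rfl⟩ |
    ⟨h1, h2, rfl, rfl⟩ | ⟨h1, h2, rfl, rfl⟩ | ⟨h1, h2, rfl, rfl⟩
  · subst h1 h2; decide
  · obtain ⟨k, rfl⟩ := key h2
    exact fin (k₁ := 0) (r₁ := 1) (k₂ := k) (r₂ := 4) (by omega) rfl (by omega) (by decide)
      (by decide) (by decide) (by decide) (by decide) (by decide) (fun _ => by decide)
  · obtain ⟨k, rfl⟩ := key h2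
    exact fin (k₁ := 0) (r₁ := 1) (k₂ := k) (r₂ := 10) (by omega) rfl (by omega) (by decide)
      (by decide) (by decide) (by decide) (by decide) (by decide) (fun _ => by decide)
  · subst h1 h2; decide
  · obtain ⟨k, rfl⟩ := key h2
    exact fin (k₁ := 0) (r₁ := 2) (k₂ := k) (r₂ := 6) (by omega) rfl (by omega) (by decide)
      (by decide) (by decide) (by decide) (by decide) (by decide) (by omega)
  · obtain ⟨k, rfl⟩ := key h2
    exact fin (k₁ := 0) (r₁ := 2) (k₂ := k) (r₂ := 10) (by omega) rfl (by omega) (by decide)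
      (by decide) (by decide) (by decide) (by decide) (by decide) (by omega)
  · obtain ⟨j, rfl⟩ := key h1
    obtain ⟨k, rfl⟩ := key h2
    exact fin (k₁ := j) (r₁ := 4) (k₂ := k) (r₂ := 4) rfl rfl (by omega) (by decide)
      (by decide) (by decide) (by decide) (by decide) (by decide) (by omega)
  · obtain ⟨j, rfl⟩ := key h1
    obtain ⟨k, rfl⟩ := key h2
    exact fin (k₁ := j) (r₁ := 4) (k₂ := k) (r₂ := 10) rfl rfl (by omega) (by decide)
      (by decide) (by decide) (by decide) (by decide) (by decide) (by omega)
  · obtain ⟨j, rfl⟩ := key h1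
    obtain ⟨k, rfl⟩ := key h2
    exact fin (k₁ := j) (r₁ := 6) (k₂ := k) (r₂ := 6) rfl rfl (by omega) (by decide)
      (by decide) (by decide) (by decide) (by decide) (by decide) (by omega)
  · obtain ⟨j, rfl⟩ := key h1
    obtain ⟨k, rfl⟩ := key h2
    exact fin (k₁ := j) (r₁ := 6) (k₂ := k) (r₂ := 10) rfl rfl (by omega) (by decide)
      (by decide) (by decide) (by decide) (by decide) (by decide) (by omega)
  · obtain ⟨j, rfl⟩ := key h1
    obtain ⟨k, rfl⟩ := key h2
    exact fin (k₁ := j) (r₁ := 10) (k₂ := k) (r₂ := 10) rfl rfl (by omega) (by decide)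
      (by decide) (by decide) (by decide) (by decide) (by decide) (by omega)

lemma sExp_comm (p₁ p₂ : ℕ) : sExp p₁ p₂ = sExp p₂ p₁ := by
  rw [sExp, sExp, mul_comm]

/-- If a prime is 2, then `p₁ p₂ ≡ 1` forces `δ` to be odd, and 3 is the only odd divisor of 24
besides 1. For odd primes 4 divides `(p₁ - 1)(p₂ - 1)`, so `s` divides 6. -/
lemma mem_of_dvd_sExp (hp₁ : p₁.Prime) (hp₂ : p₂.Prime) (hδ : δ ∣ sExp p₁ p₂)
    (hδ1 : δ ≠ 1) (hN : p₁ * p₂ ≡ 1 [MOD δ]) : δ = 2 ∨ δ = 3 ∨ δ = 6 := by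
  have hs : sExp p₁ p₂ ∣ 24 := Nat.div_dvd_of_dvd (Nat.gcd_dvd_left _ _)
  by_cases h2 : p₁ = 2 ∨ p₂ = 2
  · have hodd : ¬ 2 ∣ δ := fun h => by
      have h' : 2 ∣ p₁ * p₂ := by
        rcases h2 with rfl | rfl
        · exact dvd_mul_right _ _
        · exact dvd_mul_left _ _
      have := hN.of_dvd h
      rw [Nat.ModEq] at this
      omega
    have h24 : δ ∈ Nat.divisors 24 := by simpa using hδ.trans hs
    have : Nat.divisors 24 = {1, 2, 3, 4, 6, 8, 12, 24} := by decide
    rw [this] at h24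
    simp only [Finset.mem_insert, Finset.mem_singleton] at h24
    omega
  · push Not at h2
    have o₁ := hp₁.eq_two_or_odd'.resolve_left h2.1
    have o₂ := hp₂.eq_two_or_odd'.resolve_left h2.2
    have h4 : 4 ∣ (p₁ - 1) * (p₂ - 1) := by
      obtain ⟨a, rfl⟩ := o₁
      obtain ⟨b, rfl⟩ := o₂
      exact ⟨a * b, by simp only [Nat.add_sub_cancel]; ring⟩
    have hg : 4 ∣ Nat.gcd 24 ((p₁ - 1) * (p₂ - 1)) := Nat.dvd_gcd (by norm_num) h4
    have h6 : sExp p₁ p₂ ∣ 6 := Nat.div_dvd_div_left (Nat.gcd_dvd_left 24 _) hg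
    have h6' : δ ∈ Nat.divisors 6 := by simpa using hδ.trans h6
    have : Nat.divisors 6 = {1, 2, 3, 6} := by decide
    rw [this] at h6'
    simp only [Finset.mem_insert, Finset.mem_singleton] at h6'
    omega

/-- If `e` is odd then so is `s`, and the full factor 8 of 24 lies in the gcd. In either case `(2/p)
^ e = 1`. -/
lemma even_or_mod_eight_of_sExp {p : ℕ} (hp : 0 < p) (h : sExp 2 p = e * 3) :
    Even e ∨ p % 8 = 1 := by
  by_contra! hc
  have ho : Odd e := Nat.not_even_iff_odd.1 hc.1
  have h24 : Nat.gcd 24 ((2 - 1) * (p - 1)) * (e * 3) = 24 := by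
    rw [← h]; exact Nat.mul_div_cancel' (Nat.gcd_dvd_left _ _)
  have h8 : 8 ∣ Nat.gcd 24 ((2 - 1) * (p - 1)) := by
    have hc8 : Nat.Coprime 8 (e * 3) := by
      refine Nat.Coprime.mul_right ?_ (by norm_num)
      exact (Nat.coprime_two_left.2 ho).pow_left 3
    exact hc8.dvd_of_dvd_mul_right (by rw [h24]; norm_num)
  have := h8.trans (Nat.gcd_dvd_right _ _)
  omega

lemma Admissible.facts (hp₁ : p₁.Prime) (hp₂ : p₂.Prime) (h : Admissible p₁ p₂ e δ) :
    0 < e ∧ (δ = 2 ∨ δ = 3 ∨ δ = 6) ∧ p₁ * p₂ ≡ 1 [MOD δ] ∧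
      24 ∣ δ * (e * ((p₁ - 1) * (p₂ - 1))) ∧ (p₁ = 2 → Even e ∨ p₂ % 8 = 1) ∧
      (p₂ = 2 → Even e ∨ p₁ % 8 = 1) ∧ (p₁ = 2 → p₂ = 2 → e = 8) := by
  rcases h with ⟨he, hne, hδ, hN⟩ | h | h
  · have h24 : Nat.gcd 24 ((p₁ - 1) * (p₂ - 1)) * sExp p₁ p₂ = 24 :=
      Nat.mul_div_cancel' (Nat.gcd_dvd_left _ _)
    have hs0 : 0 < sExp p₁ p₂ := Nat.pos_of_ne_zero fun h => by rw [h] at h24; simp at h24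
    have he0 : 0 < e := Nat.pos_of_dvd_of_pos he hs0
    have hse : sExp p₁ p₂ = e * δ := by rw [hδ, Nat.mul_div_cancel' he]
    have hδ' := mem_of_dvd_sExp hp₁ hp₂ ⟨e, by rw [hse, mul_comm]⟩
      (fun h => hne (by rw [hse, h, mul_one])) hN
    have h3 : 2 ∣ p₁ * p₂ → δ = 3 := fun h' => by
      rcases hδ' with rfl | rfl | rfl
      · rw [Nat.ModEq] at hN; omega
      · rfl
      · have := hN.of_dvd (show 2 ∣ 6 by norm_num)
        rw [Nat.ModEq] at this; omega
    refine ⟨he0, hδ', hN, ?_, ?_, ?_, ?_⟩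
    · rw [← mul_assoc, mul_comm δ, ← hse]
      nth_rewrite 1 [← h24]
      rw [mul_comm]
      exact mul_dvd_mul_left _ (Nat.gcd_dvd_right _ _)
    · rintro rfl
      rw [h3 (dvd_mul_right _ _)] at hse
      exact even_or_mod_eight_of_sExp hp₂.pos hse
    · rintro rfl
      rw [h3 (dvd_mul_left _ _), sExp_comm] at hse
      exact even_or_mod_eight_of_sExp hp₁.pos hse
    · rintro rfl rfl
      rw [h3 (by decide)] at hse
      have : sExp 2 2 = 24 := by decide
      omega
  · obtain ⟨h1, h2, h3, h4, h5, h6, h7⟩ := h.facts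
    exact ⟨h1, h2, h3, h4, fun h => .inl (h5 h), fun h => .inl (h6 h), h7⟩
  · obtain ⟨h1, h2, h3, h4, h5, h6, h7⟩ := h.facts
    exact ⟨h1, h2, by rwa [mul_comm], by rwa [mul_comm (p₁ - 1)], fun h => .inl (h6 h),
      fun h => .inl (h5 h), fun h h' => h7 h' h⟩

/-! ### Product of the leading coefficients, distinct primes -/

lemma E_int_div_two_of_even {k : ℤ} (hk : Even k) : E (k / 2) = 1 := by
  obtain ⟨j, rfl⟩ := hk
  rw [← E_int j]; congr 1; push_cast; ring

lemma E_int_div_two_of_odd {k : ℤ} (hk : Odd k) : E (k / 2) = -1 := by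
  obtain ⟨j, rfl⟩ := hk
  have : (((2 * j + 1 : ℤ) : ℂ) / 2) = 1 / 2 + j := by push_cast; ring
  rw [this, E_add, E_int, mul_one, E_one_half]

lemma sum_range_natCast (n : ℕ) : ∑ ν ∈ Finset.range n, (ν : ℂ) = n * (n - 1) / 2 := by
  induction n with
  | zero => simp
  | succ n ih => rw [Finset.sum_range_succ, ih]; push_cast; ring

lemma prod_leadA (hp₁ : 0 < p₁) (hp₂ : 0 < p₂) :
    ∏ ν ∈ Finset.range (p₁ * p₂), leadA p₁ p₂ e δ ν =
      E (-rho p₁ p₂ e * (p₁ * p₂ * alpha0 δ - (p₁ * p₂ - 1) ^ 2 / 2)) := by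
  have h1 : (p₁ : ℂ) ≠ 0 := by exact_mod_cast hp₁.ne'
  have h2 : (p₂ : ℂ) ≠ 0 := by exact_mod_cast hp₂.ne'
  simp only [leadA]
  rw [← E_sum, ← Finset.mul_sum, Finset.sum_add_distrib, Finset.sum_sub_distrib,
    ← Finset.sum_div, sum_range_natCast, Finset.sum_const, Finset.card_range, nsmul_eq_mul]
  congr 2; push_cast; field_simp; ring

lemma prod_leadC2 (hp₂ : 0 < p₂) :
    ∏ ν ∈ Finset.range p₂, leadC2 p₁ p₂ e ν =
      ((eps2 p₁ p₂ : ℂ) ^ p₂) ^ e * E (rho p₁ p₂ e * ((p₂ ^ 2 - 1) / 2)) := by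
  have h2 : (p₂ : ℂ) ≠ 0 := by exact_mod_cast hp₂.ne'
  simp only [leadC2]
  rw [Finset.prod_mul_distrib, Finset.prod_const, Finset.card_range, ← E_sum, ← Finset.mul_sum,
    Finset.sum_add_distrib, ← Finset.sum_div, sum_range_natCast, ← pow_mul, ← pow_mul, mul_comm e]
  congr 3; field_simp; ring

/-- The denominator of `rho` divides `δ`, while `δ` divides both `N - 1` and `2 α₀`. The total
exponent is thus a half-integer. -/
lemma prod_leadA_sq (hp₁ : 0 < p₁) (hp₂ : 0 < p₂) (hδ : δ = 2 ∨ δ = 3 ∨ δ = 6)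
    (hN : p₁ * p₂ ≡ 1 [MOD δ]) (h24 : 24 ∣ δ * (e * ((p₁ - 1) * (p₂ - 1)))) :
    ∏ ν ∈ Finset.range (p₁ * p₂), leadA p₁ p₂ e δ ν = 1 ∨
      ∏ ν ∈ Finset.range (p₁ * p₂), leadA p₁ p₂ e δ ν = -1 := by
  obtain ⟨k, hk⟩ : (δ : ℤ) ∣ (p₁ : ℤ) * p₂ - 1 := by
    have := (Nat.modEq_iff_dvd.1 hN.symm); exact_mod_cast this
  obtain ⟨t, ht⟩ : (24 : ℤ) ∣ δ * (e * (((p₁ : ℤ) - 1) * ((p₂ : ℤ) - 1))) := by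
    have := Int.natCast_dvd_natCast.2 h24
    push_cast [Nat.cast_sub hp₁, Nat.cast_sub hp₂] at this
    exact this
  obtain ⟨c, hc⟩ : (δ : ℤ) ∣ 2 * alpha0 δ := by
    rcases hδ with rfl | rfl | rfl <;> decide
  have h : E (-rho p₁ p₂ e * (p₁ * p₂ * alpha0 δ - (p₁ * p₂ - 1) ^ 2 / 2)) =
      E ((-(t * (p₁ * p₂ * c - δ * k ^ 2)) : ℤ) / 2) := by
    congr 1
    have hk' : (p₁ : ℂ) * p₂ - 1 = δ * k := by exact_mod_cast congrArg (Int.cast : ℤ → ℂ) hk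
    have hc' : (2 : ℂ) * alpha0 δ = δ * c := by exact_mod_cast congrArg (Int.cast : ℤ → ℂ) hc
    have ht' : (δ : ℂ) * (e * (((p₁ : ℂ) - 1) * ((p₂ : ℂ) - 1))) = 24 * t := by
      exact_mod_cast congrArg (Int.cast : ℤ → ℂ) ht
    have hα : (alpha0 δ : ℂ) = δ * c / 2 := by rw [← hc']; ring
    rw [hk', hα, rho]
    push_cast
    linear_combination (-(p₁ * p₂ * c - δ * k ^ 2) / 48 : ℂ) * ht'
  rw [prod_leadA hp₁ hp₂, h]
  rcases Int.even_or_odd (-(t * (p₁ * p₂ * c - δ * k ^ 2))) with h' | h'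
  · exact .inl (E_int_div_two_of_even h')
  · exact .inr (E_int_div_two_of_odd h')

lemma alpha0_odd_of (hδ : δ = 2 ∨ δ = 6) : Odd (alpha0 δ) := by
  rcases hδ with rfl | rfl <;> decide

lemma three_dvd_alpha0_of (hδ : δ = 3 ∨ δ = 6) : 3 ∣ alpha0 δ := by
  rcases hδ with rfl | rfl <;> decide

/-- The sum of the exponents of the leading coefficients, for odd primes. -/
lemma exists_exponent_of_odd {a b N A : ℤ} (hN : N = (2 * a + 1) * (2 * b + 1))
    (hA : A = alpha0 δ) (hδ : δ = 2 ∨ δ = 3 ∨ δ = 6) (hN1 : (δ : ℤ) ∣ N - 1) (x : ℤ)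
    (h6 : 6 ∣ δ * (x * (a * b))) :
    ∃ K : ℤ, 3 * K = x * (a * b) * (2 * ((2 * a ^ 2 + 2 * a + 1) * (2 * b ^ 2 + 2 * b + 1)) -
        (N + 1) - N * A) ∧ (Even K ↔ Even (x * (a * b))) := by
  set G := 2 * ((2 * a ^ 2 + 2 * a + 1) * (2 * b ^ 2 + 2 * b + 1)) - (N + 1) - N * A with hG
  -- For `δ = 2` the factor 3 is in `x a b`; otherwise `N ≡ 1` modulo 3 and `3 ∣ α₀` put it in `G`.
  have h3 : (3 : ℤ) ∣ x * (a * b) * G := by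
    by_cases h2 : δ = 2
    · subst h2
      have : (3 : ℤ) ∣ x * (a * b) := by push_cast at h6; omega
      exact this.mul_right _
    · have hδ' : δ = 3 ∨ δ = 6 := by tauto
      refine Dvd.dvd.mul_left ?_ _
      have hd : (3 : ℤ) ∣ δ := by rcases hδ' with rfl | rfl <;> decide
      have e1 : (3 : ℤ) ∣ N * A := (hA ▸ three_dvd_alpha0_of hδ').mul_left _
      refine Int.dvd_sub ?_ e1
      have e2 := hd.trans hN1
      rw [hN] at e2 ⊢
      replace e2 := (ZMod.intCast_zmod_eq_zero_iff_dvd _ 3).2 (by exact_mod_cast e2)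
      refine (ZMod.intCast_zmod_eq_zero_iff_dvd _ 3).1 ?_
      push_cast at e2 ⊢
      generalize (a : ZMod 3) = a at *
      generalize (b : ZMod 3) = b at *
      revert a b; decide
  obtain ⟨K, hK⟩ := h3
  refine ⟨K, hK.symm, ?_⟩
  have hpar : Even (x * (a * b) * G) ↔ Even K := by
    rw [hK, Int.even_mul]; exact or_iff_right (by decide)
  rw [← hpar]
  -- For `δ = 3` the number `x a b` is even; otherwise `α₀` and `N` are odd, hence so is `G`.
  by_cases h3 : δ = 3
  · subst h3
    have : Even (x * (a * b)) := by rw [even_iff_two_dvd]; push_cast at h6; omega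
    simp [this]
  · have hδ' : δ = 2 ∨ δ = 6 := by tauto
    have hAo : Odd A := hA ▸ alpha0_odd_of hδ'
    have hNo : Odd N := by
      rw [hN]; exact (odd_two_mul_add_one a).mul (odd_two_mul_add_one b)
    have hGo : Odd G := by
      rw [hG, sub_sub]
      refine Even.sub_odd (even_two_mul _) ?_
      exact (hNo.add_odd odd_one).add_odd (hNo.mul hAo)
    rw [Int.even_mul]
    exact or_iff_left (Int.not_even_iff_odd.2 hGo)

lemma eps2_sq (hp₁ : p₁.Prime) (hp₂ : p₂.Prime) (hne : p₁ ≠ p₂) : eps2 p₁ p₂ ^ 2 = 1 := by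
  rw [eps2]
  split_ifs
  · norm_num
  · exact jacobiSym.sq_one (by simpa using (Nat.coprime_primes hp₁ hp₂).2 hne)

lemma eps2_pow_odd (hp₁ : p₁.Prime) (hp₂ : p₂.Prime) (hne : p₁ ≠ p₂) {n : ℕ} (hn : Odd n) :
    (eps2 p₁ p₂ : ℂ) ^ n = eps2 p₁ p₂ := by
  obtain ⟨k, rfl⟩ := hn
  have : (eps2 p₁ p₂ : ℂ) ^ 2 = 1 := by exact_mod_cast eps2_sq hp₁ hp₂ hne
  rw [pow_succ, pow_mul, this, one_pow, one_mul]

lemma prod_leads_eq (hp₁ : 0 < p₁) (hp₂ : 0 < p₂) :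
    (∏ ν ∈ Finset.range (p₁ * p₂), leadA p₁ p₂ e δ ν) *
        (∏ ν ∈ Finset.range p₁, leadC2 p₂ p₁ e ν) * ∏ ν ∈ Finset.range p₂, leadC2 p₁ p₂ e ν =
      ((eps2 p₂ p₁ : ℂ) ^ p₁) ^ e * ((eps2 p₁ p₂ : ℂ) ^ p₂) ^ e *
        E (rho p₁ p₂ e * ((p₁ ^ 2 + 1) * (p₂ ^ 2 + 1) / 2 - (p₁ * p₂ + 1) -
          p₁ * p₂ * alpha0 δ)) := by
  rw [prod_leadA hp₁ hp₂, prod_leadC2 hp₁, prod_leadC2 hp₂, rho_comm p₂ p₁]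
  have : E (rho p₁ p₂ e * ((p₁ ^ 2 + 1) * (p₂ ^ 2 + 1) / 2 - (p₁ * p₂ + 1) -
      p₁ * p₂ * alpha0 δ)) = E (-rho p₁ p₂ e * (p₁ * p₂ * alpha0 δ - (p₁ * p₂ - 1) ^ 2 / 2)) *
      E (rho p₁ p₂ e * ((p₁ ^ 2 - 1) / 2)) * E (rho p₁ p₂ e * ((p₂ ^ 2 - 1) / 2)) := by
    rw [← E_add, ← E_add]; congr 1; ring
  rw [this]; ring

/-- With `pᵢ = 2a + 1, 2b + 1`, reciprocity makes the product of the symbols `(-1) ^ (e a b)`. The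
root of unity is `E (K / 2)` with `K` of the same parity as `e a b`, so the two signs cancel. -/
lemma prod_leads_of_odd (hp₁ : p₁.Prime) (hp₂ : p₂.Prime) (hne : p₁ ≠ p₂) (o₁ : Odd p₁)
    (o₂ : Odd p₂) (hδ : δ = 2 ∨ δ = 3 ∨ δ = 6)
    (hN : p₁ * p₂ ≡ 1 [MOD δ]) (h24 : 24 ∣ δ * (e * ((p₁ - 1) * (p₂ - 1)))) :
    (∏ ν ∈ Finset.range (p₁ * p₂), leadA p₁ p₂ e δ ν) *
      (∏ ν ∈ Finset.range p₁, leadC2 p₂ p₁ e ν) * ∏ ν ∈ Finset.range p₂, leadC2 p₁ p₂ e ν = 1 := by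
  rw [prod_leads_eq hp₁.pos hp₂.pos, eps2_pow_odd hp₂ hp₁ hne.symm o₁, eps2_pow_odd hp₁ hp₂ hne o₂]
  have hq : eps2 p₂ p₁ * eps2 p₁ p₂ = (-1) ^ (p₁ / 2 * (p₂ / 2)) := by
    have h1 : p₁ ≠ 2 := fun h => by rw [h] at o₁; exact absurd o₁ (by decide)
    have h2 : p₂ ≠ 2 := fun h => by rw [h] at o₂; exact absurd o₂ (by decide)
    have hs := eps2_sq hp₂ hp₁ hne.symm
    simp only [eps2, h1, h2, if_false] at hs ⊢
    rw [jacobiSym.quadratic_reciprocity o₁ o₂, mul_left_comm, ← sq, hs, mul_one]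
  have hq' : (eps2 p₂ p₁ : ℂ) ^ e * (eps2 p₁ p₂ : ℂ) ^ e = (-1) ^ (e * (p₁ / 2 * (p₂ / 2))) := by
    rw [← mul_pow, mul_comm e, pow_mul]; congr 1; exact_mod_cast hq
  rw [hq']
  obtain ⟨a, rfl⟩ := o₁
  obtain ⟨b, rfl⟩ := o₂
  have ha : (2 * a + 1) / 2 = a := by omega
  have hb : (2 * b + 1) / 2 = b := by omega
  rw [ha, hb]
  have hN1 : (δ : ℤ) ∣ (2 * (a : ℤ) + 1) * (2 * (b : ℤ) + 1) - 1 := by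
    have := (Nat.modEq_iff_dvd.1 hN.symm); push_cast at this; exact this
  have h6 : (6 : ℤ) ∣ δ * (e * ((a : ℤ) * b)) := by
    have h : 4 * 6 ∣ 4 * (δ * (e * (a * b))) := by
      convert h24 using 1; simp only [Nat.add_sub_cancel]; ring
    exact_mod_cast Nat.dvd_of_mul_dvd_mul_left (by norm_num) h
  obtain ⟨K, hK, hpar⟩ := exists_exponent_of_odd rfl rfl hδ hN1 (e : ℤ) h6
  have hE : rho (2 * a + 1) (2 * b + 1) e * ((((2 * a + 1 : ℕ) : ℂ) ^ 2 + 1) *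
      (((2 * b + 1 : ℕ) : ℂ) ^ 2 + 1) / 2 - (((2 * a + 1 : ℕ) : ℂ) * ((2 * b + 1 : ℕ) : ℂ) + 1) -
      ((2 * a + 1 : ℕ) : ℂ) * ((2 * b + 1 : ℕ) : ℂ) * alpha0 δ) = K / 2 := by
    have hK' := congrArg (Int.cast : ℤ → ℂ) hK
    push_cast at hK' ⊢
    rw [rho]; push_cast
    linear_combination (-1 / 6 : ℂ) * hK'
  rw [hE]
  have hpar' : Even K ↔ Even (e * (a * b)) := by
    rw [hpar, ← Int.even_coe_nat]; push_cast; rfl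
  rcases Nat.even_or_odd (e * (a * b)) with h | h
  · rw [E_int_div_two_of_even (hpar'.2 h), h.neg_one_pow, one_mul]
  · rw [E_int_div_two_of_odd (Int.not_even_iff_odd.1 fun h' =>
      (Nat.not_even_iff_odd.2 h) (hpar'.1 h')), h.neg_one_pow]; norm_num

lemma prod_leads_of_two {p : ℕ} (hp : p.Prime) (hp2 : p ≠ 2) (hδ : δ = 2 ∨ δ = 3 ∨ δ = 6)
    (hN : 2 * p ≡ 1 [MOD δ]) (h24 : 24 ∣ δ * (e * ((2 - 1) * (p - 1))))
    (he : Even e ∨ p % 8 = 1) :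
    (∏ ν ∈ Finset.range (2 * p), leadA 2 p e δ ν) *
      (∏ ν ∈ Finset.range 2, leadC2 p 2 e ν) * ∏ ν ∈ Finset.range p, leadC2 2 p e ν = 1 := by
  have o := hp.eq_two_or_odd'.resolve_left hp2
  have h3 : δ = 3 := by
    rcases hδ with rfl | rfl | rfl
    · rw [Nat.ModEq] at hN; omega
    · rfl
    · have := hN.of_dvd (show 2 ∣ 6 by norm_num)
      rw [Nat.ModEq] at this; omega
  subst h3
  have hα : alpha0 3 = 0 := by decide
  have hε : (eps2 2 p : ℂ) ^ e = 1 := by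
    rcases he with he | he
    · obtain ⟨k, rfl⟩ := he
      have : (eps2 2 p : ℂ) ^ 2 = 1 := by
        exact_mod_cast eps2_sq Nat.prime_two hp (Ne.symm hp2)
      rw [← two_mul, pow_mul, this, one_pow]
    · have : eps2 2 p = 1 := by
        rw [eps2, if_neg hp2, Nat.cast_ofNat, jacobiSym.at_two o, ZMod.χ₈_nat_eq_if_mod_eight]
        rw [if_neg (by omega), if_pos (by omega)]
      rw [this]; simp
  have hε' : eps2 p 2 = 1 := by simp [eps2]
  rw [prod_leads_eq two_pos hp.pos, eps2_pow_odd Nat.prime_two hp (Ne.symm hp2) o, hε, hε', hα]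
  simp only [Int.cast_one, one_pow, one_mul]
  obtain ⟨b, rfl⟩ := o
  have h4 : 4 ∣ e * b := by
    have h : 6 * 4 ∣ 6 * (e * b) := by
      convert h24 using 1; simp only [Nat.add_sub_cancel]; ring
    exact Nat.dvd_of_mul_dvd_mul_left (by norm_num) h
  obtain ⟨t, ht⟩ := h4
  have hb : b % 3 = 2 := by rw [Nat.ModEq] at hN; omega
  obtain ⟨c, rfl⟩ : ∃ c, b = 3 * c + 2 := ⟨b / 3, by omega⟩
  -- With `p = 6c + 5` one has `5 (p² + 1)/2 - (2p + 1) = 6 (15c² + 23c + 9)`, and `rho = e b / 12 =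
  -- t / 3`.
  refine (congrArg E ?_).trans (E_int (2 * t * (15 * c ^ 2 + 23 * c + 9)))
  have ht' := congrArg (Nat.cast : ℕ → ℂ) ht
  rw [rho]; push_cast at ht' ⊢
  linear_combination ((15 * c ^ 2 + 23 * c + 9) / 2 : ℂ) * ht'

lemma prod_leads (hp₁ : p₁.Prime) (hp₂ : p₂.Prime) (hadm : Admissible p₁ p₂ e δ)
    (hne : p₁ ≠ p₂) :
    (∏ ν ∈ Finset.range (p₁ * p₂), leadA p₁ p₂ e δ ν) *
      (∏ ν ∈ Finset.range p₁, leadC2 p₂ p₁ e ν) * ∏ ν ∈ Finset.range p₂, leadC2 p₁ p₂ e ν = 1 := by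
  obtain ⟨-, hδ, hN, h24, h1, h2, -⟩ := hadm.facts hp₁ hp₂
  by_cases e1 : p₁ = 2
  · subst e1
    exact prod_leads_of_two hp₂ hne.symm hδ hN h24 (h1 rfl)
  by_cases e2 : p₂ = 2
  · subst e2
    have := prod_leads_of_two hp₁ hne hδ (by rwa [mul_comm]) (by rwa [mul_comm (2 - 1)]) (h2 rfl)
    rw [← this, mul_comm p₁ 2, mul_right_comm]
    congr 2
    refine Finset.prod_congr rfl fun ν _ => ?_
    rw [leadA, leadA, rho_comm, mul_comm (p₁ : ℂ)]
  exact prod_leads_of_odd hp₁ hp₂ hne (hp₁.eq_two_or_odd'.resolve_left e1)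
    (hp₂.eq_two_or_odd'.resolve_left e2) hδ hN h24

end DoubleEta

/-! ### Product of the leading coefficients, equal primes -/

namespace DoubleEta

variable {p e δ : ℕ}

lemma dvd_one_add_muIdx_mul (hp : p.Prime) {ν : ℕ} (hν : ν ∈ Finset.Ico 1 p) :
    (p : ℤ) ∣ 1 + muIdx 1 p ν * ν := by
  have := Fact.mk hp
  rw [Finset.mem_Ico] at hν
  have h0 : (ν : ZMod p) ≠ 0 := by
    rw [Ne, ZMod.natCast_eq_zero_iff]
    exact fun h => absurd (Nat.le_of_dvd hν.1 h) (by omega)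
  rw [← ZMod.intCast_zmod_eq_zero_iff_dvd]
  push_cast
  rw [muIdx, ZMod.natCast_val, ZMod.cast_id, inv_neg, Nat.cast_one, mul_one, neg_mul,
    inv_mul_cancel₀ h0, add_neg_cancel]

/-- Substituting `μν = wp - 1`, the difference is a multiple of `p² - 1`, which is divisible by 24
except for `p = 3`, where `e` supplies the factor 3. The term `(p - 1)² μ` is the one that `χ ^ μ`
cancels. -/
lemma dvd_thetaEq_sub (hp : p.Prime) (hp2 : p ≠ 2) (he : p = 3 → 3 ∣ e) {ν : ℕ}
    (hν : ν ∈ Finset.Ico 1 p) :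
    (24 : ℤ) ∣ e * (thetaEq p ν - ((p : ℤ) - 1) ^ 2 * muIdx 1 p ν - p * ν - 3 * ((p : ℤ) - 1)) := by
  obtain ⟨w, hw⟩ := dvd_one_add_muIdx_mul hp hν
  have hp0 : (p : ℤ) ≠ 0 := by exact_mod_cast hp.ne_zero
  have hw' : (1 + (muIdx 1 p ν : ℤ) * ν) / p = w := by rw [hw, Int.mul_ediv_cancel_left _ hp0]
  have h24 : (24 : ℤ) ∣ e * ((p : ℤ) ^ 2 - 1) := by
    have h8 : (8 : ℤ) ∣ e * ((p : ℤ) ^ 2 - 1) := by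
      have ho : Odd (p : ℤ) := by exact_mod_cast hp.eq_two_or_odd'.resolve_left hp2
      exact (Int.eight_dvd_sq_sub_one_of_odd ho).mul_left _
    have h3 : (3 : ℤ) ∣ e * ((p : ℤ) ^ 2 - 1) := by
      by_cases h : p = 3
      · exact Dvd.dvd.mul_right (by exact_mod_cast he h) _
      · refine Dvd.dvd.mul_left ?_ _
        have hd : ¬ 3 ∣ p := fun hd => h ((Nat.prime_dvd_prime_iff_eq Nat.prime_three hp).1 hd).symm
        have hm : (p : ℤ) % 3 = 1 ∨ (p : ℤ) % 3 = 2 := by omega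
        rw [Int.dvd_iff_emod_eq_zero, Int.sub_emod, pow_two, Int.mul_emod]
        rcases hm with h | h <;> rw [h] <;> rfl
    omega
  have : e * (thetaEq p ν - ((p : ℤ) - 1) ^ 2 * muIdx 1 p ν - p * ν - 3 * ((p : ℤ) - 1)) =
      e * ((p : ℤ) ^ 2 - 1) * (-(muIdx 1 p ν * (1 + w))) := by
    rw [thetaEq, if_neg hp2]
    simp only [hw']
    linear_combination (-e * p * muIdx 1 p ν : ℤ) * hw
  rw [this]
  exact h24.mul_right _

lemma leadC_eq (hp : p.Prime) (hp2 : p ≠ 2) (he : p = 3 → 3 ∣ e) {ν : ℕ}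
    (hν : ν ∈ Finset.Ico 1 p) :
    leadC p e ν = ((Real.sqrt p : ℂ) * epsEq p ν) ^ e *
      E (e * (p * ν + 3 * (p - 1) - ν / p) / 24) := by
  obtain ⟨k, hk⟩ := dvd_thetaEq_sub hp hp2 he hν
  have hk' := congrArg (Int.cast : ℤ → ℂ) hk
  push_cast at hk'
  have h : -rho p p e * muIdx 1 p ν + e * (thetaEq p ν - ν / p) / 24 =
      e * (p * ν + 3 * (p - 1) - ν / p) / 24 + k := by
    rw [rho]
    linear_combination (1 / 24 : ℂ) * hk'
  rw [leadC, h, E_add, E_int, mul_one]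

/-- By multiplicativity the product is the symbol of `∏ (-ν)`, which is `-1` modulo `p` by Wilson's
theorem. -/
lemma prod_epsEq (hp : p.Prime) (hp2 : p ≠ 2) :
    ∏ ν ∈ Finset.Ico 1 p, epsEq p ν = (-1) ^ (p / 2) := by
  have := Fact.mk hp
  have ho := hp.eq_two_or_odd'.resolve_left hp2
  have h1 : ∏ ν ∈ Finset.Ico 1 p, epsEq p ν = jacobiSym (∏ ν ∈ Finset.Ico 1 p, (-(ν : ℤ))) p := by
    simp only [epsEq, if_neg hp2]
    induction Finset.Ico 1 p using Finset.cons_induction with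
    | empty => simp
    | cons a s ha ih => rw [Finset.prod_cons, Finset.prod_cons, jacobiSym.mul_left, ih]
  have h2 : ((∏ ν ∈ Finset.Ico 1 p, (-(ν : ℤ)) : ℤ) : ZMod p) = ((-1 : ℤ) : ZMod p) := by
    have he : Even (p - 1) := by
      obtain ⟨k, rfl⟩ := ho
      simp
    rw [Finset.prod_neg, Nat.card_Ico, he.neg_one_pow, one_mul]
    push_cast
    exact ZMod.prod_Ico_one_prime p
  rw [h1, jacobiSym.mod_left' ((ZMod.intCast_eq_intCast_iff' _ _ p).1 h2), jacobiSym.at_neg_one ho,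
    ZMod.χ₄_eq_neg_one_pow (Nat.odd_iff.1 ho)]

lemma prod_leadC (hp : p.Prime) (hp2 : p ≠ 2) (he : p = 3 → 3 ∣ e) :
    ∏ ν ∈ Finset.Ico 1 p, leadC p e ν =
      (-(p : ℂ)) ^ (e * (p - 1) / 2) * E (rho p p e * ((p + 7) / 2)) := by
  have hp0 : (p : ℂ) ≠ 0 := by exact_mod_cast hp.ne_zero
  have hsum : ∑ ν ∈ Finset.Ico 1 p, (ν : ℂ) = p * (p - 1) / 2 := by
    rw [← sum_range_natCast, Finset.range_eq_Ico, Finset.sum_eq_sum_Ico_succ_bot hp.pos]; simp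
  have hcard : ((p - 1 : ℕ) : ℂ) = p - 1 := by rw [Nat.cast_sub hp.one_le]; simp
  have hexp : ∑ ν ∈ Finset.Ico 1 p, ((e : ℂ) * (p * ν + 3 * (p - 1) - ν / p) / 24) =
      rho p p e * ((p + 7) / 2) := by
    rw [← Finset.sum_div, ← Finset.mul_sum, Finset.sum_sub_distrib, Finset.sum_add_distrib,
      ← Finset.mul_sum, ← Finset.sum_div, hsum, Finset.sum_const, Nat.card_Ico, nsmul_eq_mul,
      hcard, rho]
    field_simp; ring
  rw [Finset.prod_congr rfl fun ν hν => leadC_eq hp hp2 he hν, Finset.prod_mul_distrib, ← E_sum,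
    hexp, Finset.prod_pow, Finset.prod_mul_distrib, Finset.prod_const, Nat.card_Ico]
  congr 1
  have h : ∏ ν ∈ Finset.Ico 1 p, (epsEq p ν : ℂ) = (-1) ^ (p / 2) := by
    exact_mod_cast prod_epsEq hp hp2
  rw [h]
  obtain ⟨a, rfl⟩ := hp.eq_two_or_odd'.resolve_left hp2
  have h1 : (2 * a + 1) / 2 = a := by omega
  have h2 : e * (2 * a + 1 - 1) / 2 = a * e := by
    rw [Nat.add_sub_cancel, mul_left_comm, Nat.mul_div_cancel_left _ two_pos, mul_comm]
  have h3 : (Real.sqrt ((2 * a + 1 : ℕ) : ℝ) : ℂ) ^ 2 = (2 * a + 1 : ℕ) := by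
    rw [← Complex.ofReal_pow, Real.sq_sqrt (Nat.cast_nonneg _), Complex.ofReal_natCast]
  rw [h1, h2, Nat.add_sub_cancel, pow_mul, h3, ← mul_pow, mul_neg_one, ← pow_mul]

lemma prod_leads_of_eq (hp : p.Prime) (hp2 : p ≠ 2) (hδ : δ = 2 ∨ δ = 3 ∨ δ = 6)
    (hN : p * p ≡ 1 [MOD δ]) (h24 : 24 ∣ δ * (e * ((p - 1) * (p - 1)))) :
    (∏ ν ∈ Finset.range (p * p), leadA p p e δ ν) * ∏ ν ∈ Finset.Ico 1 p, leadC p e ν =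
      (-(p : ℂ)) ^ (e * (p - 1) / 2) := by
  -- Here `9 ≡ 1` modulo `δ` leaves only `δ = 2`, and then `24 ∣ 8 e`.
  have he : p = 3 → 3 ∣ e := by
    rintro rfl
    rcases hδ with rfl | rfl | rfl
    · omega
    · exact absurd hN (by decide)
    · exact absurd hN (by decide)
  rw [prod_leadA hp.pos hp.pos, prod_leadC hp hp2 he, mul_left_comm, ← E_add]
  refine (congrArg _ ?_).trans (mul_one _)
  obtain ⟨a, rfl⟩ := hp.eq_two_or_odd'.resolve_left hp2
  have h6 : (6 : ℤ) ∣ δ * (e * (a : ℤ) ^ 2) := by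
    have h : 4 * 6 ∣ 4 * (δ * (e * a ^ 2)) := by
      convert h24 using 1; simp only [Nat.add_sub_cancel]; ring
    exact_mod_cast Nat.dvd_of_mul_dvd_mul_left (by norm_num) h
  have hN1 : (δ : ℤ) ∣ (2 * (a : ℤ) + 1) ^ 2 - 1 := by
    have := (Nat.modEq_iff_dvd.1 hN.symm); push_cast at this; rwa [← sq] at this
  -- With `p = 2a + 1` the total exponent is `e a² G / 6`; divisibility by 2 and by 3 is checked
  -- separately.
  set G : ℤ := 8 * (a : ℤ) ^ 2 * (a + 1) ^ 2 + a + 4 - (2 * a + 1) ^ 2 * alpha0 δ with hG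
  have d2 : (2 : ℤ) ∣ e * (a : ℤ) ^ 2 * G := by
    by_cases h3 : δ = 3
    · subst h3
      have : (2 : ℤ) ∣ e * (a : ℤ) ^ 2 := by push_cast at h6; omega
      exact this.mul_right _
    · have hα := alpha0_odd_of (show δ = 2 ∨ δ = 6 by tauto)
      rw [← even_iff_two_dvd, hG]
      rcases Int.even_or_odd a with h | h
      · exact ((h.pow_of_ne_zero two_ne_zero).mul_left _).mul_right _
      · refine Even.mul_left ?_ _
        have h8 : Even (8 * (a : ℤ) ^ 2 * (a + 1) ^ 2) := by
          rw [mul_assoc]; exact Even.mul_right (by decide) _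
        refine Odd.sub_odd ((h8.add_odd h).add_even (by decide)) ?_
        exact ((odd_two_mul_add_one _).pow).mul hα
  have d3 : (3 : ℤ) ∣ e * (a : ℤ) ^ 2 * G := by
    by_cases h2 : δ = 2
    · subst h2
      have : (3 : ℤ) ∣ e * (a : ℤ) ^ 2 := by push_cast at h6; omega
      exact this.mul_right _
    · have hδ' : δ = 3 ∨ δ = 6 := by tauto
      rw [mul_assoc, hG, mul_sub]
      refine Dvd.dvd.mul_left ?_ _
      have hd : (3 : ℤ) ∣ δ := by rcases hδ' with rfl | rfl <;> decide
      refine Int.dvd_sub ?_ (((three_dvd_alpha0_of hδ').mul_left _).mul_left _)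
      have e2 := (ZMod.intCast_zmod_eq_zero_iff_dvd _ 3).2 (by exact_mod_cast hd.trans hN1)
      refine (ZMod.intCast_zmod_eq_zero_iff_dvd _ 3).1 ?_
      push_cast at e2 ⊢
      generalize (a : ZMod 3) = a at *
      revert a; decide
  obtain ⟨k, hk⟩ : (6 : ℤ) ∣ e * (a : ℤ) ^ 2 * G := by omega
  refine (congrArg E ?_).trans (E_int k)
  have hk' := congrArg (Int.cast : ℤ → ℂ) hk
  rw [hG] at hk'
  push_cast at hk'
  rw [rho]; push_cast
  linear_combination (1 / 6 : ℂ) * hk'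

lemma prod_leads_two_two (hδ : δ = 2 ∨ δ = 3 ∨ δ = 6) (hN : 2 * 2 ≡ 1 [MOD δ]) :
    (∏ ν ∈ Finset.range (2 * 2), leadA 2 2 8 δ ν) * ∏ ν ∈ Finset.Ico 1 2, leadC 2 8 ν = 2 ^ 4 := by
  have h3 : δ = 3 := by
    rcases hδ with rfl | rfl | rfl
    · exact absurd hN (by decide)
    · rfl
    · exact absurd hN (by decide)
  subst h3
  have hα : alpha0 3 = 0 := by decide
  have hμ : muIdx 1 2 1 = 1 := by
    rw [muIdx, Nat.cast_one, mul_one, ZMod.neg_eq_self_mod_two, inv_one, ZMod.val_one]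
  have hs : (Real.sqrt 2 : ℂ) ^ 8 = 2 ^ 4 := by
    rw [show 8 = 2 * 4 by norm_num, pow_mul, ← Complex.ofReal_pow, Real.sq_sqrt two_pos.le]
    norm_num
  rw [prod_leadA two_pos two_pos, hα]
  have h1 : Finset.Ico 1 2 = {1} := by decide
  rw [h1, Finset.prod_singleton, leadC, hμ]
  simp only [thetaEq, epsEq, if_true, Nat.cast_ofNat, Int.cast_one, mul_one, hs]
  rw [mul_left_comm, ← E_add]
  refine (congrArg _ ?_).trans (mul_one _)
  -- With `rho = 1/3` the exponents add up to `3/2 - 1/3 - 1/6 = 1`.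
  refine (congrArg E ?_).trans (E_int 1)
  rw [rho]; norm_num

end DoubleEta

/-! ### The modular polynomial, its trace and its constant term -/

namespace DoubleEta

open Polynomial

variable {p₁ p₂ e δ : ℕ}

lemma DominantCoeff.exists_puiseux {D : ℕ} (hD : 0 < D) {P : ℍ → ℂ[X]} {m : ℕ} {K : ℤ} {c : ℂ}
    (hc : c ≠ 0) {x : ℚ} (hx : x = K / D) (h : DominantCoeff D P m K c) :
    ∃ s : ℕ → HahnSeries ℚ ℂ, (∀ k, IsPuiseuxExpansion (fun z => (P z).coeff k) (s k)) ∧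
      (s m).orderTop = (x : WithTop ℚ) ∧ (s m).leadingCoeff = c ∧
      ∀ k, k ≠ m → (s m).orderTop < (s k).orderTop := by
  obtain ⟨s₀, h₀, hK, hlt⟩ := h.1.exists_puiseux hD
  have key : ∀ k, k ≠ m → ∃ s : HahnSeries ℚ ℂ,
      IsPuiseuxExpansion (fun z => (P z).coeff k) s ∧ (x : WithTop ℚ) < s.orderTop := by
    intro k hk
    obtain ⟨d, hd⟩ := h.2 k hk
    obtain ⟨s, hs, -, hs'⟩ := hd.exists_puiseux hD
    refine ⟨s, hs, lt_of_lt_of_le ?_ (HahnSeries.le_orderTop_iff_forall.2 fun y hy =>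
      hs' y (WithTop.coe_lt_coe.1 hy))⟩
    rw [WithTop.coe_lt_coe, hx]
    have : (0 : ℚ) < D := by exact_mod_cast hD
    push_cast
    gcongr
    linarith
  choose! s hs hs' using key
  obtain ⟨ho, hl⟩ := orderTop_eq_and_leadingCoeff_eq hc hK hlt
  refine ⟨Function.update s m s₀, fun k => ?_, ?_, ?_, fun k hk => ?_⟩
  · by_cases hk : k = m
    · subst hk; simpa using h₀
    · simpa [hk] using hs k hk
  · simpa [hx] using ho
  · simpa using hl
  · rw [Function.update_self, Function.update_of_ne hk, ho, ← hx]
    exact hs' k hk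

lemma modPoly_of_ne (hne : p₁ ≠ p₂) (u v : ℤ) (z : ℂ) :
    modPoly p₁ p₂ e δ u v z = (X - C (conjB' p₁ p₂ e z)) *
      (∏ ν ∈ Finset.range (p₁ * p₂), (X - C (conjA' p₁ p₂ e δ ν z))) *
      ((∏ ν ∈ Finset.range p₁, (X - C (conjC2' p₂ p₁ e v u ν z))) *
        ∏ ν ∈ Finset.range p₂, (X - C (conjC2' p₁ p₂ e u v ν z))) := by
  simp only [modPoly, conjugates, if_neg hne, Multiset.map_add, Multiset.prod_add,
    Multiset.map_singleton, Multiset.prod_singleton, Multiset.map_map]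
  rfl

lemma modPoly_of_eq {p : ℕ} (u v : ℤ) (z : ℂ) :
    modPoly p p e δ u v z = (X - C (conjB' p p e z)) *
      (∏ ν ∈ Finset.range (p * p), (X - C (conjA' p p e δ ν z))) *
      ∏ ν ∈ Finset.Ico 1 p, (X - C (conjC' p e ν z)) := by
  simp only [modPoly, conjugates, if_true, Multiset.map_add, Multiset.prod_add,
    Multiset.map_singleton, Multiset.prod_singleton, Multiset.map_map]
  rfl

lemma trace_of_ne (hne : p₁ ≠ p₂) (u v : ℤ) (z : ℂ) :
    trace p₁ p₂ e δ u v z = conjB' p₁ p₂ e z +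
      (∑ ν ∈ Finset.range (p₁ * p₂), conjA' p₁ p₂ e δ ν z) +
      ((∑ ν ∈ Finset.range p₁, conjC2' p₂ p₁ e v u ν z) +
        ∑ ν ∈ Finset.range p₂, conjC2' p₁ p₂ e u v ν z) := by
  simp only [trace, conjugates, if_neg hne, Multiset.sum_add, Multiset.sum_singleton]
  rfl

lemma trace_of_eq {p : ℕ} (u v : ℤ) (z : ℂ) :
    trace p p e δ u v z = conjB' p p e z +
      (∑ ν ∈ Finset.range (p * p), conjA' p p e δ ν z) +
      ∑ ν ∈ Finset.Ico 1 p, conjC' p e ν z := by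
  simp only [trace, conjugates, if_true, Multiset.sum_add, Multiset.sum_singleton]
  rfl

lemma hasLead_conjC2'_swap (hp₁ : 0 < p₁) (hp₂ : 0 < p₂) (u v : ℤ) (ν : ℕ) :
    HasLead (24 * (p₁ * p₂)) (fun z => conjC2' p₂ p₁ e v u ν z)
      (e * ((p₂ - 1) * (p₁ - 1)) * p₂) (leadC2 p₂ p₁ e ν) := by
  rw [mul_comm p₁]; exact hasLead_conjC2' hp₂ hp₁ v u ν

/-- The index counts the conjugates of positive order. In units of `1/D`, `B'` and the `A_ν'`
together contribute equal halves of the exponent. -/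
lemma dominantCoeff_modPoly (hp₁ : 1 < p₁) (hp₂ : 1 < p₂) (he : 0 < e) (u v : ℤ) :
    DominantCoeff (24 * (p₁ * p₂)) (fun z => modPoly p₁ p₂ e δ u v z)
      (if p₁ = p₂ then p₁ - 1 else p₁ + p₂) (-(2 * (e * ((p₁ - 1) * (p₂ - 1))) * (p₁ * p₂)))
      (-1 * ∏ ν ∈ Finset.range (p₁ * p₂), -leadA p₁ p₂ e δ ν) := by
  have h₁ : (1 : ℤ) < p₁ := by exact_mod_cast hp₁
  have h₂ : (1 : ℤ) < p₂ := by exact_mod_cast hp₂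
  have he' : (0 : ℤ) < e := by exact_mod_cast he
  have hm : (0 : ℤ) < e * ((p₁ - 1) * (p₂ - 1)) :=
    mul_pos he' (mul_pos (by omega) (by omega))
  have hB := DominantCoeff.X_sub_C_of_neg (hasLead_conjB' (e := e) (p₁ := p₁) (p₂ := p₂)
    (by omega) (by omega)) (neg_lt_zero.2 (by positivity))
  have hA := DominantCoeff.prod (Finset.range (p₁ * p₂)) fun ν _ =>
    DominantCoeff.X_sub_C_of_neg (hasLead_conjA' (e := e) (p₁ := p₁) (p₂ := p₂)
      (by omega) (by omega) δ ν) (neg_lt_zero.2 hm)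
  by_cases hne : p₁ = p₂
  · subst hne
    have hC := DominantCoeff.prod (Finset.Ico 1 p₁) fun ν _ =>
      DominantCoeff.X_sub_C_of_pos (hasLead_conjC' (e := e) (p := p₁) (by omega) ν)
        (mul_pos (mul_pos (mul_pos two_pos he') (by omega)) (by positivity))
    convert (hB.mul hA).mul hC using 1
    · funext z; exact modPoly_of_eq u v z
    · simp
    · simp; ring
    · simp
  · have hC₁ := DominantCoeff.prod (Finset.range p₁) fun ν _ =>
      DominantCoeff.X_sub_C_of_pos (hasLead_conjC2'_swap (e := e) (p₁ := p₁) (p₂ := p₂)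
        (by omega) (by omega) u v ν)
        (mul_pos (mul_pos he' (mul_pos (by omega) (by omega))) (by positivity))
    have hC₂ := DominantCoeff.prod (Finset.range p₂) fun ν _ =>
      DominantCoeff.X_sub_C_of_pos (hasLead_conjC2' (e := e) (p₁ := p₁) (p₂ := p₂)
        (by omega) (by omega) u v ν) (mul_pos hm (by positivity))
    convert (hB.mul hA).mul (hC₁.mul hC₂) using 1
    · funext z; exact modPoly_of_ne hne u v z
    · simp [hne]
    · simp; ring
    · simp

/-- All conjugates other than `B'` have order strictly above `-re`, so `of_lt` lets them enter with
coefficient 0. -/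
lemma hasLead_trace (hp₁ : 1 < p₁) (hp₂ : 1 < p₂) (he : 0 < e) (u v : ℤ) :
    HasLead (24 * (p₁ * p₂)) (fun z => trace p₁ p₂ e δ u v z)
      (-(e * ((p₁ - 1) * (p₂ - 1)) * (p₁ * p₂))) 1 := by
  have h₁ : (1 : ℤ) < p₁ := by exact_mod_cast hp₁
  have h₂ : (1 : ℤ) < p₂ := by exact_mod_cast hp₂
  have he' : (0 : ℤ) < e := by exact_mod_cast he
  have hm : (0 : ℤ) < e * ((p₁ - 1) * (p₂ - 1)) :=
    mul_pos he' (mul_pos (by omega) (by omega))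
  have hK : -((e : ℤ) * ((p₁ - 1) * (p₂ - 1)) * (p₁ * p₂)) < 0 := neg_lt_zero.2 (by positivity)
  have hKA : -((e : ℤ) * ((p₁ - 1) * (p₂ - 1)) * (p₁ * p₂)) < -(e * ((p₁ - 1) * (p₂ - 1))) :=
    neg_lt_neg (lt_mul_of_one_lt_right hm (one_lt_mul h₁.le h₂))
  have hB := hasLead_conjB' (e := e) (p₁ := p₁) (p₂ := p₂) (by omega) (by omega)
  have hA := HasLead.sum (Finset.range (p₁ * p₂)) fun ν _ =>
    (hasLead_conjA' (e := e) (p₁ := p₁) (p₂ := p₂) (by omega) (by omega) δ ν).of_lt hKA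
  by_cases hne : p₁ = p₂
  · subst hne
    have hC := HasLead.sum (Finset.Ico 1 p₁) fun ν _ =>
      (hasLead_conjC' (e := e) (p := p₁) (by omega) ν).of_lt (hK.trans
        (mul_pos (mul_pos (mul_pos two_pos he') (by omega)) (by positivity)))
    convert (hB.add hA).add hC using 1
    · funext z; exact trace_of_eq u v z
    · simp
  · have hC₁ := HasLead.sum (Finset.range p₁) fun ν _ =>
      (hasLead_conjC2'_swap (e := e) (p₁ := p₁) (p₂ := p₂) (by omega) (by omega) u v ν).of_lt
        (hK.trans (mul_pos (mul_pos he' (mul_pos (by omega) (by omega))) (by positivity)))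
    have hC₂ := HasLead.sum (Finset.range p₂) fun ν _ =>
      (hasLead_conjC2' (e := e) (p₁ := p₁) (p₂ := p₂) (by omega) (by omega) u v ν).of_lt
        (hK.trans (mul_pos hm (by positivity)))
    convert (hB.add hA).add (hC₁.add hC₂) using 1
    · funext z; exact trace_of_ne hne u v z
    · simp

lemma prod_conjA' (hp₁ : 0 < p₁) (hp₂ : 0 < p₂) (δ : ℕ) (z : ℂ) :
    ∏ ν ∈ Finset.range (p₁ * p₂), conjA' p₁ p₂ e δ ν z =
      (∏ ν ∈ Finset.range (p₁ * p₂), leadA p₁ p₂ e δ ν) * E (-rho p₁ p₂ e * z) *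
        (∏ ν ∈ Finset.range (p₁ * p₂), eulerA p₁ p₂ ν z) ^ e := by
  have h1 : (p₁ : ℂ) ≠ 0 := by exact_mod_cast hp₁.ne'
  have h2 : (p₂ : ℂ) ≠ 0 := by exact_mod_cast hp₂.ne'
  simp only [conjA'_eq hp₁ hp₂, Finset.prod_mul_distrib, Finset.prod_const, Finset.card_range,
    Finset.prod_pow, ← E_nat_mul]
  congr 3; push_cast; field_simp

lemma prod_conjC2' (hp₁ : 0 < p₁) (hp₂ : 0 < p₂) (u v : ℤ) (z : ℂ) :
    ∏ ν ∈ Finset.range p₂, conjC2' p₁ p₂ e u v ν z =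
      (∏ ν ∈ Finset.range p₂, leadC2 p₁ p₂ e ν) * E (rho p₁ p₂ e * z) *
        (∏ ν ∈ Finset.range p₂, eulerC2 p₁ p₂ ν z) ^ e := by
  have h2 : (p₂ : ℂ) ≠ 0 := by exact_mod_cast hp₂.ne'
  simp only [conjC2'_eq hp₁ hp₂, Finset.prod_mul_distrib, Finset.prod_const, Finset.card_range,
    Finset.prod_pow, ← E_nat_mul]
  congr 3; field_simp

lemma prod_conjC' {p : ℕ} (hp : 0 < p) (z : ℂ) :
    ∏ ν ∈ Finset.Ico 1 p, conjC' p e ν z =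
      (∏ ν ∈ Finset.Ico 1 p, leadC p e ν) * E (2 * (rho p p e * z)) *
        (∏ ν ∈ Finset.Ico 1 p, eulerC p ν z) ^ e := by
  simp only [conjC'_eq hp, Finset.prod_mul_distrib, Finset.prod_const, Nat.card_Ico,
    Finset.prod_pow, ← E_nat_mul]
  congr 3; rw [rho, Nat.cast_sub hp]; push_cast; ring

lemma eval_modPoly_of_ne (hp₁ : p₁.Prime) (hp₂ : p₂.Prime) (hne : p₁ ≠ p₂)
    (hadm : Admissible p₁ p₂ e δ) (u v : ℤ) (z : ℍ) :
    (modPoly p₁ p₂ e δ u v z).eval 0 = 1 := by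
  have hz := z.im_pos
  have hz' : 0 < (z : ℂ).im := hz
  -- The degree is `(p₁ + 1)(p₂ + 1)`, which is even because two distinct primes are not both 2.
  have hsign : Even (1 + p₁ * p₂ + (p₁ + p₂)) := by
    rw [show 1 + p₁ * p₂ + (p₁ + p₂) = (p₁ + 1) * (p₂ + 1) by ring, Nat.even_mul]
    by_contra! h
    rw [Nat.not_even_iff_odd, Nat.not_even_iff_odd] at h
    have e1 := hp₁.eq_two_or_odd'.resolve_right fun ho => by
      have := ho.add_one; exact absurd h.1 (Nat.not_odd_iff_even.2 this)
    have e2 := hp₂.eq_two_or_odd'.resolve_right fun ho => by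
      have := ho.add_one; exact absurd h.2 (Nat.not_odd_iff_even.2 this)
    exact hne (e1.trans e2.symm)
  have hB0 : eulerB p₁ p₂ z ≠ 0 := by
    rw [eulerB, mul_assoc (p₁ : ℂ)]
    exact div_ne_zero (mul_ne_zero (eulerProd_E_ne_zero (im_nat_mul_pos hp₁.pos hz'))
      (eulerProd_E_ne_zero (im_nat_mul_pos hp₂.pos hz'))) (mul_ne_zero (eulerProd_E_ne_zero hz')
      (eulerProd_E_ne_zero (im_nat_mul_pos hp₁.pos (im_nat_mul_pos hp₂.pos hz'))))
  have hE : E (-rho p₁ p₂ e * z) * E (rho p₁ p₂ e * z) = 1 := by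
    rw [← E_add, ← E_zero]; congr 1; ring
  have hswap : eulerB p₂ p₁ z = eulerB p₁ p₂ z := by
    rw [eulerB, eulerB, mul_comm (p₁ : ℂ) p₂]; ring
  have hlead := prod_leads hp₁ hp₂ hadm hne
  rw [modPoly_of_ne hne]
  simp only [eval_mul, eval_prod, eval_sub, eval_X, eval_C, zero_sub, Finset.prod_neg,
    Finset.card_range]
  rw [prod_conjA' hp₁.pos hp₂.pos, prod_conjC2' hp₂.pos hp₁.pos, prod_conjC2' hp₁.pos hp₂.pos,
    conjB'_eq, prod_eulerA_of_ne hp₁ hp₂ hne hz', prod_eulerC2 hp₁ hp₂ hne hz',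
    prod_eulerC2 hp₂ hp₁ hne.symm hz', hswap, rho_comm p₂ p₁, inv_pow]
  have hBe : eulerB p₁ p₂ z ^ e * (eulerB p₁ p₂ z ^ e)⁻¹ = 1 := mul_inv_cancel₀ (pow_ne_zero _ hB0)
  have hs : (-1 : ℂ) ^ (1 + p₁ * p₂ + (p₁ + p₂)) = 1 := hsign.neg_one_pow
  rw [pow_add, pow_add, pow_add, pow_one] at hs
  generalize eulerB p₁ p₂ z ^ e = b at *
  generalize b⁻¹ = b' at *
  calc _ = (-1 * (-1) ^ (p₁ * p₂) * ((-1) ^ p₁ * (-1) ^ p₂)) *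
        ((∏ ν ∈ Finset.range (p₁ * p₂), leadA p₁ p₂ e δ ν) *
          (∏ ν ∈ Finset.range p₁, leadC2 p₂ p₁ e ν) * ∏ ν ∈ Finset.range p₂, leadC2 p₁ p₂ e ν) *
        (E (-rho p₁ p₂ e * z) * E (rho p₁ p₂ e * z)) ^ 2 * (b * b') ^ 2 := by ring
    _ = 1 := by rw [hs, hlead, hE, hBe]; norm_num

lemma eval_modPoly_of_eq {p : ℕ} (hp : p.Prime) (u v : ℤ) (z : ℍ) :
    (modPoly p p e δ u v z).eval 0 =
      (∏ ν ∈ Finset.range (p * p), leadA p p e δ ν) * ∏ ν ∈ Finset.Ico 1 p, leadC p e ν := by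
  have hz' : 0 < (z : ℂ).im := z.im_pos
  have hsign : Even (1 + p * p + (p - 1)) := by
    rw [show 1 + p * p + (p - 1) = p * (p + 1) by
      obtain ⟨k, rfl⟩ : ∃ k, p = k + 1 := ⟨p - 1, by have := hp.pos; omega⟩
      rw [Nat.add_sub_cancel]; ring]
    exact Nat.even_mul_succ_self p
  have hE : E (-rho p p e * z) ^ 2 * E (2 * (rho p p e * z)) = 1 := by
    rw [← E_nat_mul, ← E_add, ← E_zero]; congr 1; push_cast; ring
  have hP : eulerB p p z ^ e * (∏ ν ∈ Finset.range (p * p), eulerA p p ν z) ^ e *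
      (∏ ν ∈ Finset.Ico 1 p, eulerC p ν z) ^ e = 1 := by
    rw [← mul_pow, ← mul_pow, prod_eulerA_mul_prod_eulerC hp hz', one_pow]
  have hs : (-1 : ℂ) ^ (1 + p * p + (p - 1)) = 1 := hsign.neg_one_pow
  rw [pow_add, pow_add, pow_one] at hs
  rw [modPoly_of_eq]
  simp only [eval_mul, eval_prod, eval_sub, eval_X, eval_C, zero_sub, Finset.prod_neg,
    Finset.card_range, Nat.card_Ico]
  rw [prod_conjA' hp.pos hp.pos, prod_conjC' hp.pos, conjB'_eq]
  calc _ = (-1 * (-1) ^ (p * p) * (-1) ^ (p - 1)) *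
        ((∏ ν ∈ Finset.range (p * p), leadA p p e δ ν) * ∏ ν ∈ Finset.Ico 1 p, leadC p e ν) *
        (E (-rho p p e * z) ^ 2 * E (2 * (rho p p e * z))) *
        (eulerB p p z ^ e * (∏ ν ∈ Finset.range (p * p), eulerA p p ν z) ^ e *
          (∏ ν ∈ Finset.Ico 1 p, eulerC p ν z) ^ e) := by ring
    _ = _ := by rw [hs, hE, hP]; ring

end DoubleEta

theorem mainTheorem9 (p₁ p₂ e δ : ℕ) (hp₁ : p₁.Prime) (hp₂ : p₂.Prime)
    (hadm : DoubleEta.Admissible p₁ p₂ e δ)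
    (u v : ℤ) (huv : p₁ ≠ p₂ → u * p₁ + v * p₂ = 1) :
    -- (a) the coefficient of smallest order, attained exactly once, is `± q^(-2re) (1 + ⋯)`
    (∃ c : ℕ → HahnSeries ℚ ℂ,
      (∀ k, DoubleEta.IsPuiseuxExpansion
        (fun z : UpperHalfPlane => (DoubleEta.modPoly p₁ p₂ e δ u v z).coeff k) (c k)) ∧
      (c (if p₁ = p₂ then p₁ - 1 else p₁ + p₂)).orderTop =
        ((-(2 * DoubleEta.rExp p₁ p₂ * e) : ℚ) : WithTop ℚ) ∧
      ((c (if p₁ = p₂ then p₁ - 1 else p₁ + p₂)).leadingCoeff = 1 ∨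
        (c (if p₁ = p₂ then p₁ - 1 else p₁ + p₂)).leadingCoeff = -1) ∧
      ∀ k, k ≠ (if p₁ = p₂ then p₁ - 1 else p₁ + p₂) →
        (c (if p₁ = p₂ then p₁ - 1 else p₁ + p₂)).orderTop < (c k).orderTop) ∧
    -- (b) the trace has the expansion `q^(-re) (1 + ⋯)`
    (∃ t : HahnSeries ℚ ℂ,
      DoubleEta.IsPuiseuxExpansion
        (fun z : UpperHalfPlane => DoubleEta.trace p₁ p₂ e δ u v z) t ∧
      t.orderTop = ((-(DoubleEta.rExp p₁ p₂ * e) : ℚ) : WithTop ℚ) ∧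
      t.leadingCoeff = 1) ∧
    -- (c) the constant term for distinct primes
    (p₁ ≠ p₂ → ∀ z : UpperHalfPlane, (DoubleEta.modPoly p₁ p₂ e δ u v z).eval 0 = 1) ∧
    -- (d) the constant term for equal primes
    (p₁ = p₂ → p₁ ≠ 2 → ∀ z : UpperHalfPlane,
      (DoubleEta.modPoly p₁ p₂ e δ u v z).eval 0 = (-(p₁ : ℂ)) ^ (e * (p₁ - 1) / 2)) ∧
    (p₁ = p₂ → p₁ = 2 → ∀ z : UpperHalfPlane,
      (DoubleEta.modPoly p₁ p₂ e δ u v z).eval 0 = 2 ^ 4) := by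
  obtain ⟨he, hδ, hN, h24, -, -, h2⟩ := hadm.facts hp₁ hp₂
  have h₁ : (p₁ : ℚ) ≠ 0 := by exact_mod_cast hp₁.ne_zero
  have h₂ : (p₂ : ℚ) ≠ 0 := by exact_mod_cast hp₂.ne_zero
  have hD : 0 < 24 * (p₁ * p₂) := mul_pos (by norm_num) (mul_pos hp₁.pos hp₂.pos)
  refine ⟨?_, ?_, fun hne => DoubleEta.eval_modPoly_of_ne hp₁ hp₂ hne hadm u v, ?_, ?_⟩
  · have hc : ∀ {a b : ℂ}, (a = 1 ∨ a = -1) → (b = 1 ∨ b = -1) → (a * b = 1 ∨ a * b = -1) := by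
      rintro a b (rfl | rfl) (rfl | rfl) <;> simp
    have hlead : (-1 * ∏ ν ∈ Finset.range (p₁ * p₂), -DoubleEta.leadA p₁ p₂ e δ ν) = 1 ∨
        (-1 * ∏ ν ∈ Finset.range (p₁ * p₂), -DoubleEta.leadA p₁ p₂ e δ ν) = -1 := by
      rw [Finset.prod_neg]
      exact hc (.inr rfl) (hc (neg_one_pow_eq_or ℂ _)
        (DoubleEta.prod_leadA_sq hp₁.pos hp₂.pos hδ hN h24))
    obtain ⟨s, hs, ho, hl, hlt⟩ := (DoubleEta.dominantCoeff_modPoly (δ := δ) hp₁.one_lt hp₂.one_lt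
      he u v).exists_puiseux hD (x := -(2 * DoubleEta.rExp p₁ p₂ * e))
      (by rcases hlead with h | h <;> rw [h] <;> norm_num)
      (by rw [DoubleEta.rExp]; push_cast; field_simp)
    exact ⟨s, hs, ho, by rw [hl]; exact hlead, hlt⟩
  · obtain ⟨t, ht, hK, hlt⟩ := (DoubleEta.hasLead_trace (δ := δ) hp₁.one_lt hp₂.one_lt
      he u v).exists_puiseux hD
    have hx : ((-(e * ((p₁ - 1) * (p₂ - 1)) * (p₁ * p₂)) : ℤ) / (24 * (p₁ * p₂) : ℕ) : ℚ) =
        -(DoubleEta.rExp p₁ p₂ * e) := by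
      rw [DoubleEta.rExp]; push_cast; field_simp
    rw [hx] at hK hlt
    exact ⟨t, ht, DoubleEta.orderTop_eq_and_leadingCoeff_eq one_ne_zero hK hlt⟩
  · rintro rfl hp z
    rw [DoubleEta.eval_modPoly_of_eq hp₁, DoubleEta.prod_leads_of_eq hp₁ hp hδ hN h24]
  · rintro rfl rfl z
    obtain rfl := h2 rfl rfl
    rw [DoubleEta.eval_modPoly_of_eq hp₁, DoubleEta.prod_leads_two_two hδ hN]
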